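/- Conventions. Let $d\ge 1$; functions take values in $\mathbf{R}$ or in $\mathbf{C}$. A cube is a set $\prod_{j=1}^d[a_j,a_j+\ell)$ with $\ell>0$, and $\sup_Q$ runs over all cubes. For $0<p<\infty$ put $\langle f\rangle_{p,Q}=(|Q|^{-1}\int_Q|f|^p\,dx)^{1/p}$, and $\langle f\rangle_{\infty,Q}=\operatorname{ess\,sup}_Q|f|$. A weight is a measurable function $w$ with $w>0$ a.e., and $w(Q)=\int_Q w\,dx$. Put $$[w]_1=\sup_Q\langle w\rangle_{1,Q}\langle w^{-1}\rangle_{\infty,Q},\qquad [w]_{\mathrm{FW}}=\sup_Q\frac1{w(Q)}\int_Q M(w\mathbf 1_Q)\,dx,\qquad Mf=\sup_Q\langle f\rangle_{1,Q}\mathbf 1_Q,$$ and write $w\in A_1$ if $[w]_1<\infty$. For $p>0$ put $\|f\|_{L^p_w}=\|fw\|_{L^p(\mathbf{R}^d)}$ and $\|f\|_{L^{p,\infty}_w}=\sup_{\lambda>0}\|\lambda\mathbf 1_{\{|f|>\lambda\}}\|_{L^p_w}$. Let $L^\infty_0$ be the space of essentially bounded functions on $\mathbf{R}^d$ with compact support.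 For $\alpha\in\{0,\frac13,\frac23\}^d$ let $\mathcal D^\alpha=\{2^{-j}([0,1)^d+(-1)^j\alpha+k):j\in\mathbf{Z},\,k\in\mathbf{Z}^d\}$. A collection $\mathcal S$ of cubes is sparse if $\mathcal S=\bigcup_{\alpha}\mathcal S^\alpha$ with $\mathcal S^\alpha\subseteq\mathcal D^\alpha$ such that, for every $\alpha$ and $Q\in\mathcal S^\alpha$, one has $\sum_{Q'}|Q'|\le\frac12|Q|$, where $Q'$ runs over the maximal elements of $\mathcal S^\alpha$ properly contained in $Q$. Let $r,q>0$. An operator $T$ from $L^\infty_0$ to measurable functions satisfies $(r,\infty)$ limited-range sparse domination of $\ell^q$-type if there is a constant $C_T$ such that for all $f\in L^\infty_0$ and $g\in L^1(\mathbf{R}^d)$ there is a sparse collection $\mathcal S$ with $$\Big(\int_{\mathbf{R}^d}|Tf|^q|g|\,dx\Big)^{1/q}\le C_T\Big(\sum_{Q\in\mathcal S}\langle f\rangle_{r,Q}^q\,\langle g\rangle_{1,Q}\,|Q|\Big)^{1/q}.$$ An operator $T'$ is called an extension of $T$ to $L^r_w$ (by density) if $T'f=Tf$ a.e. for $f\in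 L^\infty_0$, and for each $f\in L^r_w$ there are $f_n\in L^\infty_0$ with $\|f_n-f\|_{L^r_w}\to0$ and $Tf_n\to T'f$ a.e. Corollary C. Let $r,q>0$ and let $T$ satisfy $(r,\infty)$ limited-range sparse domination of $\ell^q$-type. There is a constant $C$, depending only on $d,r,q$ and $T$, such that for every weight $w$ with $w^r\in A_1$, with $$B(w)=\begin{cases}[w^r]_1^{\frac1r}\,[w^r]_{\mathrm{FW}}^{\frac1q-\frac1r}\,(1+\log[w^r]_{\mathrm{FW}})^{\frac1r}&\text{if }q\le r,\\[2pt] [w^r]_1^{\frac1r}&\text{if }q>r,\end{cases}$$ the following hold. (1) $\|Tf\|_{L^{r,\infty}_w}\le C\,B(w)\,\|f\|_{L^r_w}$ for all $f\in L^\infty_0$. (2) Every extension $T'$ of $T$ to $L^r_w$ satisfies $\|T'\|_{L^r_w\to L^{r,\infty}_w}\le C\,B(w)$, that is, $\|T'f\|_{L^{r,\infty}_w}\le C\,B(w)\,\|f\|_{L^r_w}$ for all $f\in L^r_w$. (3) If moreover $|Tf-Tg|\le|T(f-g)|$ a.e. for all $f,g\in L^\infty_0$ (for instance if $T$ is linear),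 then an extension of $T$ to $L^r_w$ exists, and it is unique up to equality a.e. -/

import Mathlib

open MeasureTheory Filter Topology
open scoped ENNReal NNReal

namespace SparseWeak

/-- A cube in `ℝ^d`: a product of half-open intervals `[a_j, a_j + ℓ)` of one common length
`ℓ > 0`. -/
def IsCube {d : ℕ} (Q : Set (Fin d → ℝ)) : Prop :=
  ∃ (a : Fin d → ℝ) (l : ℝ), 0 < l ∧ Q = Set.univ.pi fun i => Set.Ico (a i) (a i + l)

/-- The dyadic grid with shift `α / 3`, where `α ∈ {0, 1, 2}^d`: all the cubes
`2^{-j} ([0,1)^d + (-1)^j α / 3 + k)` with `j ∈ ℤ` and `k ∈ ℤ^d`. -/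
def dyadicGrid {d : ℕ} (α : Fin d → Fin 3) : Set (Set (Fin d → ℝ)) :=
  {Q | ∃ (j : ℤ) (k : Fin d → ℤ), Q = Set.univ.pi fun i =>
    Set.Ico ((2 : ℝ) ^ (-j) * ((-1 : ℝ) ^ j * (((α i : ℕ) : ℝ) / 3) + (k i : ℝ)))
      ((2 : ℝ) ^ (-j) * ((-1 : ℝ) ^ j * (((α i : ℕ) : ℝ) / 3) + (k i : ℝ) + 1))}

/-- `ch_P(Q)`: the maximal elements of the collection `P` among those properly contained
in `Q`. -/
def children {d : ℕ} (P : Set (Set (Fin d → ℝ))) (Q : Set (Fin d → ℝ)) :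
    Set (Set (Fin d → ℝ)) :=
  {Q' | Maximal (fun R => R ∈ P ∧ R ⊂ Q) Q'}

/-- `η`-sparse collections of cubes. -/
def IsSparse {d : ℕ} (η : ℝ) (S : Set (Set (Fin d → ℝ))) : Prop :=
  ∃ F : (Fin d → Fin 3) → Set (Set (Fin d → ℝ)),
    S = ⋃ α, F α ∧
    ∀ α, F α ⊆ dyadicGrid α ∧
      ∀ Q ∈ F α, ∑' Q' : children (F α) Q, volume (Q' : Set (Fin d → ℝ)) ≤
        ENNReal.ofReal (1 - η) * volume Q

/-- The average `⟨f⟩_{p,Q}`, for `0 < p ≤ ∞`: the `L^p` (quasi-)norm of `f` for the normalized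
Lebesgue measure on `Q`; for `p = ∞` this is the essential supremum of `|f|` over `Q`. -/
noncomputable def avg {d : ℕ} {F : Type*} [NormedAddCommGroup F] (p : ℝ≥0∞)
    (Q : Set (Fin d → ℝ)) (f : (Fin d → ℝ) → F) : ℝ≥0∞ :=
  eLpNorm f p ((volume Q)⁻¹ • volume.restrict Q)

/-- The Hardy-Littlewood maximal function over all cubes. -/
noncomputable def maximalFn {d : ℕ} (f : (Fin d → ℝ) → ℝ) (x : Fin d → ℝ) : ℝ≥0∞ :=
  ⨆ (Q : Set (Fin d → ℝ)) (_ : IsCube Q), Q.indicator (fun _ => avg 1 Q f) x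

/-- A weight: a measurable function that is positive almost everywhere. -/
def IsWeight {d : ℕ} (w : (Fin d → ℝ) → ℝ) : Prop :=
  AEMeasurable w ∧ ∀ᵐ x, 0 < w x

/-- `w(A) = ∫_A w dx`. -/
noncomputable def weightMass {d : ℕ} (w : (Fin d → ℝ) → ℝ) (A : Set (Fin d → ℝ)) : ℝ≥0∞ :=
  ∫⁻ x in A, ENNReal.ofReal (w x)

/-- The Muckenhoupt constant `[w]_1 = sup_Q ⟨w⟩_{1,Q} ⟨w⁻¹⟩_{∞,Q}`. -/
noncomputable def A1const {d : ℕ} (w : (Fin d → ℝ) → ℝ) : ℝ≥0∞ :=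
  ⨆ (Q : Set (Fin d → ℝ)) (_ : IsCube Q), avg 1 Q w * avg ∞ Q (fun x => (w x)⁻¹)

/-- `w ∈ A_1`. -/
def IsA1 {d : ℕ} (w : (Fin d → ℝ) → ℝ) : Prop :=
  IsWeight w ∧ A1const w < ∞

/-- The Fujii-Wilson constant `[w]_FW = sup_Q w(Q)⁻¹ ∫_Q M(w 1_Q) dx`. -/
noncomputable def FWconst {d : ℕ} (w : (Fin d → ℝ) → ℝ) : ℝ≥0∞ :=
  ⨆ (Q : Set (Fin d → ℝ)) (_ : IsCube Q),
    (weightMass w Q)⁻¹ * ∫⁻ x in Q, maximalFn (Q.indicator w) x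

/-- `‖f‖_{L^p_w} = ‖f w‖_{L^p}`. -/
noncomputable def wNorm {d : ℕ} {F : Type*} [NormedAddCommGroup F] [NormedSpace ℝ F]
    (p : ℝ) (w : (Fin d → ℝ) → ℝ) (f : (Fin d → ℝ) → F) : ℝ≥0∞ :=
  eLpNorm (fun x => w x • f x) (ENNReal.ofReal p) volume

/-- `f ∈ L^p_w`. -/
def MemW {d : ℕ} {F : Type*} [NormedAddCommGroup F] [NormedSpace ℝ F]
    (p : ℝ) (w : (Fin d → ℝ) → ℝ) (f : (Fin d → ℝ) → F) : Prop :=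
  MemLp (fun x => w x • f x) (ENNReal.ofReal p) volume

/-- `‖f‖_{L^{p,∞}_w} = sup_{λ > 0} ‖λ 1_{|f| > λ}‖_{L^p_w}`. -/
noncomputable def wWeakNorm {d : ℕ} {F : Type*} [NormedAddCommGroup F]
    (p : ℝ) (w : (Fin d → ℝ) → ℝ) (f : (Fin d → ℝ) → F) : ℝ≥0∞ :=
  ⨆ (t : ℝ) (_ : 0 < t), wNorm p w ({x | t < ‖f x‖}.indicator fun _ => t)

/-- `f ∈ L_0^∞`: essentially bounded, and vanishing almost everywhere off a compact set. -/
def MemL0 {d : ℕ} {F : Type*} [NormedAddCommGroup F] (f : (Fin d → ℝ) → F) : Prop :=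
  MemLp f ∞ volume ∧ ∃ K : Set (Fin d → ℝ), IsCompact K ∧ ∀ᵐ x, x ∉ K → f x = 0

/-- `T` satisfies `(r,s)` limited-range sparse domination of `ℓ^q`-type. Here `T` is an operator
from `L_0^∞` to measurable functions, given on representatives; its values elsewhere play
no role. -/
def SparseDominated {d : ℕ} {F : Type*} [NormedAddCommGroup F] (r : ℝ) (s : ℝ≥0∞) (q : ℝ)
    (T : ((Fin d → ℝ) → F) → ((Fin d → ℝ) → F)) : Prop :=
  ∃ C : ℝ≥0, ∀ f : (Fin d → ℝ) → F, MemL0 f → ∀ g : (Fin d → ℝ) → F, MemLp g 1 volume →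
    ∃ S : Set (Set (Fin d → ℝ)), IsSparse (1 / 2) S ∧
      (∫⁻ x, ‖T f x‖ₑ ^ q * ‖g x‖ₑ) ^ (1 / q) ≤
        C * (∑' Q : S, avg (ENNReal.ofReal r) Q f ^ q *
          avg (ENNReal.conjExponent (s / ENNReal.ofReal q)) Q g *
            volume (Q : Set (Fin d → ℝ))) ^ (1 / q)

/-- `|Tf - Tg| ≤ |T(f - g)|` on `L_0^∞`; this holds for linear operators and for square
functions. -/
def IsSublinear {d : ℕ} {F : Type*} [NormedAddCommGroup F]
    (T : ((Fin d → ℝ) → F) → ((Fin d → ℝ) → F)) : Prop :=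
  ∀ f g : (Fin d → ℝ) → F, MemL0 f → MemL0 g → ∀ᵐ x, ‖T f x - T g x‖ ≤ ‖T (f - g) x‖

/-- `T'` extends the operator `T` from `L_0^∞` to `L^p_w` by density: it agrees with `T` on
`L_0^∞`, and every `f ∈ L^p_w` is the limit in `L^p_w` of a sequence `f_n ∈ L_0^∞` for which
`T f_n → T' f` almost everywhere. -/
def IsExtension {d : ℕ} {F : Type*} [NormedAddCommGroup F] [NormedSpace ℝ F]
    (p : ℝ) (w : (Fin d → ℝ) → ℝ) (T T' : ((Fin d → ℝ) → F) → ((Fin d → ℝ) → F)) : Prop :=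
  (∀ f, MemL0 f → T' f =ᵐ[volume] T f) ∧
  ∀ f, MemW p w f → ∃ u : ℕ → (Fin d → ℝ) → F, (∀ n, MemL0 (u n)) ∧
    Tendsto (fun n => wNorm p w (u n - f)) atTop (𝓝 0) ∧
    ∀ᵐ x, Tendsto (fun n => T (u n) x) atTop (𝓝 (T' f x))

/-- `‖T‖_{L^p_w → L^{p,∞}_w}`: the smallest `K` with `‖T f‖_{L^{p,∞}_w} ≤ K ‖f‖_{L^p_w}` for all
`f ∈ L^p_w` (it is `∞` if there is no such finite `K`). -/
noncomputable def weakOpNorm {d : ℕ} {F : Type*} [NormedAddCommGroup F] [NormedSpace ℝ F]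
    (p : ℝ) (w : (Fin d → ℝ) → ℝ) (T : ((Fin d → ℝ) → F) → ((Fin d → ℝ) → F)) : ℝ≥0∞ :=
  sInf {K | ∀ f, MemW p w f → wWeakNorm p w (T f) ≤ K * wNorm p w f}

/-- The bound, as a function of `v = w^r`. The logarithm is the `[-∞,∞]`-valued one, brought to
`[0,∞]`: nothing is lost, as `[v]_FW ≥ 1`. -/
noncomputable def weakBound {d : ℕ} (r q : ℝ) (v : (Fin d → ℝ) → ℝ) : ℝ≥0∞ :=
  if q ≤ r then
    A1const v ^ (1 / r) * FWconst v ^ (1 / q - 1 / r) *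
      (1 + (ENNReal.log (FWconst v)).toENNReal) ^ (1 / r)
  else A1const v ^ (1 / r)

end SparseWeak

/-!
Write `v = w ^ r`, `h = ‖f‖ ^ r`, `p = q / r` and `x_Q = |Q|⁻¹ ∫_Q h`, so that
`⟨f⟩_{r,Q} ^ q = x_Q ^ p`.

**The weak type bound.** To bound `v({‖T f‖ > t})`, first remove the set `Ω` where one of the dyadic
maximal functions of `h` exceeds `(δ t) ^ r`; the weighted weak type `(1, 1)` inequality
(`IsWeight.weightMeasure_dyadicSuperlevel_le`) controls `v(Ω)` by a multiple of
`[v]₁ t ^ (-r) ∫ h v`. On the remaining set `E`, the sparse domination is tested with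
`g = v 1_E`, and only cubes with
`x_Q ≤ (δ t) ^ r` contribute. The resulting sum `∑ x_Q ^ p v(Q ∩ E)` is estimated in
`exists_sparse_sum_bound`; it contains a small multiple of `t ^ q v(E)`, which is absorbed
(`SparseDominated.exists_good_bound`).

**The sparse sum.** The cubes are sorted into levels `x_Q ≈ t₀ (2 / 3) ^ k`. On one level the ratio
`3 / 2` of the densities and the sparseness constant `1 / 2` multiply to `3 / 4 < 1`, so each cube
keeps a quarter of its `h`-mass off its descendants, and the `A₁` condition bounds `∑ x_Q v(Q)` by
a multiple of `[v]₁ ∫ h v` without any further loss (`IsFinSparse.mul_sum_measure_le`). For `p > 1`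
these estimates sum geometrically. For `p ≤ 1` they do not, and the high levels need the packing
condition `∑_{R ⊆ Q} v(R) ≤ Λ v(Q)`: it bounds all moments of the number of cubes through a point
(`lintegral_mult_pow_le`), so points in more than `Λ y` cubes carry a mass that decays
faster than any power of `y`, whereas those in fewer cubes cost only `Λ y v(E)`
(`IsCarleson.sum_measure_inter_le`). Switching at the level `K` with `(3 / 2) ^ (K p) ≈ Λ` yields
the factor `Λ ^ (1 / p - 1) (1 + log Λ)`; the logarithm counts the low levels.

**The packing constant.** It may be taken to be `2 [v]_FW`, by the definition of the Fujii-Wilson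
constant and the disjointness of the cores of a sparse family, and also `2 [v]₁`. Using
the smaller one keeps the bound finite whether or not `[v]_FW` is known to be.

**Extensions.** The bound passes to extensions by lower semicontinuity of the distribution function
(`mul_measure_lt_norm_le_of_tendsto`). Applied to differences, it makes `T (u n)` converge almost
everywhere for a fast sequence `u n → f` (Borel-Cantelli) and makes two limits agree.
-/

namespace SparseWeak

/-! ### Laminar families -/

section Laminar

variable {X : Type*}

/-- A family of sets is laminar if any two of its members are nested or disjoint. -/
def IsLaminar (P : Set (Set X)) : Prop :=
  ∀ Q ∈ P, ∀ R ∈ P, Q ⊆ R ∨ R ⊆ Q ∨ Disjoint Q R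

lemma IsLaminar.mono {P P' : Set (Set X)} (h : IsLaminar P) (hP : P' ⊆ P) : IsLaminar P' :=
  fun Q hQ R hR => h Q (hP hQ) R (hP hR)

/-- The part of `Q` that is covered by no member of `P` properly contained in `Q`. -/
def core (P : Finset (Set X)) (Q : Set X) : Set X :=
  Q \ ⋃ R ∈ {R | R ∈ P ∧ R ⊂ Q}, R

lemma core_subset (P : Finset (Set X)) (Q : Set X) : core P Q ⊆ Q := Set.sdiff_subset

lemma countable_properSubsets (P : Finset (Set X)) (Q : Set X) :
    {R | R ∈ P ∧ R ⊂ Q}.Countable :=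
  (P.countable_toSet).mono fun _ h => h.1

lemma pairwiseDisjoint_core {P : Finset (Set X)} (hP : IsLaminar (P : Set (Set X))) :
    (P : Set (Set X)).PairwiseDisjoint (core P) := by
  have key : ∀ Q ∈ P, ∀ R ∈ P, Q ≠ R → Q ⊆ R → Disjoint (core P Q) (core P R) := by
    intro Q hQ R hR hne hQR
    refine Set.disjoint_left.2 fun x hx hx' => hx'.2 ?_
    exact Set.mem_biUnion (x := Q) ⟨hQ, hQR.ssubset_of_ne hne⟩ hx.1
  intro Q hQ R hR hne
  rcases hP Q hQ R hR with h | h | h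
  · exact key Q hQ R hR hne h
  · exact (key R hR Q hQ hne.symm h).symm
  · exact h.mono (core_subset P Q) (core_subset P R)

lemma biUnion_properSubsets_subset (P : Finset (Set X)) (Q : Set X) :
    (⋃ R ∈ {R | R ∈ P ∧ R ⊂ Q}, R) ⊆ Q :=
  Set.iUnion₂_subset fun _ hR => hR.2.subset

/-- The number of members of `P` that contain `x`. -/
noncomputable def mult (P : Finset (Set X)) (x : X) : ℝ≥0∞ :=
  ∑ Q ∈ P, Q.indicator 1 x

lemma mult_eq_card (P : Finset (Set X)) (x : X) [DecidablePred fun Q : Set X => x ∈ Q] :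
    mult P x = ((P.filter fun Q => x ∈ Q).card : ℝ≥0∞) := by
  simp [mult, Set.indicator_apply, Finset.sum_boole]

open Classical in
/-- For a finite chain, the discrete form of `N ^ (n + 1) = (n + 1) ∫₀ᴺ t ^ n dt`: the numbers
of members below a given member are `1, …, N`. -/
lemma card_pow_succ_le_of_chain (n : ℕ) (c : Finset (Set X))
    (hc : ∀ Q ∈ c, ∀ R ∈ c, Q ⊆ R ∨ R ⊆ Q) :
    c.card ^ (n + 1) ≤ (n + 1) * ∑ Q ∈ c, (c.filter (· ⊆ Q)).card ^ n := by
  induction hN : c.card generalizing c with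
  | zero => simp
  | succ N ih =>
    have hne : c.Nonempty := Finset.card_pos.1 (by omega)
    obtain ⟨Q₀, hQ₀⟩ := c.exists_maximal hne
    have htop : ∀ R ∈ c, R ⊆ Q₀ := fun R hR => (hc R hR Q₀ hQ₀.1).elim id fun h => hQ₀.2 hR h
    have ih' := ih (c.erase Q₀)
      (fun Q hQ R hR => hc Q (Finset.mem_of_mem_erase hQ) R (Finset.mem_of_mem_erase hR))
      (by rw [Finset.card_erase_of_mem hQ₀.1, hN]; rfl)
    have hrest : ∀ Q ∈ c.erase Q₀, (c.erase Q₀).filter (· ⊆ Q) = c.filter (· ⊆ Q) := by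
      intro Q hQ
      ext R
      simp only [Finset.mem_filter, Finset.mem_erase]
      refine ⟨fun h => ⟨h.1.2, h.2⟩, fun h => ⟨⟨?_, h.1⟩, h.2⟩⟩
      rintro rfl
      exact (Finset.mem_erase.1 hQ).1 (subset_antisymm (htop Q (Finset.mem_of_mem_erase hQ)) h.2)
    have hall : c.filter (· ⊆ Q₀) = c := Finset.filter_true_of_mem htop
    rw [← Finset.sum_erase_add _ _ hQ₀.1, hall, hN, mul_add]
    rw [Finset.sum_congr rfl fun Q hQ => by rw [hrest Q hQ]] at ih'
    have hstep : (N + 1) ^ (n + 1) ≤ N ^ (n + 1) + (n + 1) * (N + 1) ^ n := by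
      clear * -
      induction n with
      | zero => simp
      | succ n ih =>
        calc (N + 1) ^ (n + 1 + 1) = N * (N + 1) ^ (n + 1) + (N + 1) ^ (n + 1) := by ring
          _ ≤ N * (N ^ (n + 1) + (n + 1) * (N + 1) ^ n) + (N + 1) ^ (n + 1) := by gcongr
          _ = N ^ (n + 1 + 1) + (n + 1) * (N * (N + 1) ^ n) + (N + 1) ^ (n + 1) := by ring
          _ ≤ N ^ (n + 1 + 1) + (n + 1) * ((N + 1) * (N + 1) ^ n) + (N + 1) ^ (n + 1) := by
            gcongr; omega
          _ = _ := by ring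
    exact hstep.trans (by gcongr)

open Classical in
lemma mult_pow_succ_le {P : Finset (Set X)} (hP : IsLaminar (P : Set (Set X))) (n : ℕ) (x : X) :
    mult P x ^ (n + 1) ≤ (n + 1) * ∑ Q ∈ P, mult (P.filter (· ⊆ Q)) x ^ n := by
  set c := P.filter fun Q => x ∈ Q with hc
  have h := card_pow_succ_le_of_chain n c (by
    intro Q hQ R hR
    rw [hc, Finset.mem_filter] at hQ hR
    rcases hP Q hQ.1 R hR.1 with h | h | h
    · exact Or.inl h
    · exact Or.inr h
    · exact absurd hR.2 (Set.disjoint_left.1 h hQ.2))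
  have h' : (c.card : ℝ≥0∞) ^ (n + 1)
      ≤ (n + 1) * ∑ Q ∈ c, ((c.filter (· ⊆ Q)).card : ℝ≥0∞) ^ n := by exact_mod_cast h
  rw [mult_eq_card]
  refine h'.trans (mul_le_mul_right ?_ _)
  refine (Finset.sum_le_sum fun Q _ => ?_).trans
    (Finset.sum_le_sum_of_subset (Finset.filter_subset _ _))
  rw [mult_eq_card, hc, Finset.filter_comm]

variable [MeasurableSpace X]

lemma measurableSet_core {P : Finset (Set X)} (hm : ∀ Q ∈ P, MeasurableSet Q) {Q : Set X}
    (hQ : Q ∈ P) : MeasurableSet (core P Q) :=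
  (hm Q hQ).diff (MeasurableSet.biUnion (countable_properSubsets P Q) fun R hR => hm R hR.1)

/-- An inequality between two measures on every member of a finite laminar family passes to the
union of the family, since the union is the disjoint union of the maximal members. -/
lemma measure_biUnion_le_of_isLaminar {P : Finset (Set X)} (hm : ∀ Q ∈ P, MeasurableSet Q)
    (hP : IsLaminar (P : Set (Set X))) (μ ν : Measure X) (c : ℝ≥0∞)
    (h : ∀ Q ∈ P, μ Q ≤ c * ν Q) : μ (⋃ Q ∈ P, Q) ≤ c * ν (⋃ Q ∈ P, Q) := by
  classical
  set M := P.filter fun Q => Maximal (· ∈ P) Q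
  have hMP : ∀ Q ∈ M, Q ∈ P := fun Q hQ => (Finset.mem_filter.1 hQ).1
  have hsub : (⋃ Q ∈ P, Q) = ⋃ Q ∈ M, Q := by
    refine subset_antisymm (Set.iUnion₂_subset fun Q hQ => ?_)
      (Set.iUnion₂_subset fun Q hQ => Set.subset_biUnion_of_mem (u := id) (hMP Q hQ))
    obtain ⟨R, hQR, hR⟩ := P.exists_le_maximal hQ
    exact (show Q ⊆ R from hQR).trans
      (Set.subset_biUnion_of_mem (u := id) (Finset.mem_filter.2 ⟨hR.1, hR⟩ : R ∈ M))
  have hdisj : (M : Set (Set X)).PairwiseDisjoint id := by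
    intro Q hQ R hR hne
    have hQ' := (Finset.mem_filter.1 hQ).2
    have hR' := (Finset.mem_filter.1 hR).2
    rcases hP Q hQ'.1 R hR'.1 with h | h | h
    · exact absurd (hQ'.eq_of_le hR'.1 h) hne
    · exact absurd (hR'.eq_of_le hQ'.1 h).symm hne
    · exact h
  rw [hsub]
  calc μ (⋃ Q ∈ M, Q) ≤ ∑ Q ∈ M, μ Q := measure_biUnion_finset_le _ _
    _ ≤ ∑ Q ∈ M, c * ν Q := Finset.sum_le_sum fun Q hQ => h Q (hMP Q hQ)
    _ = c * ν (⋃ Q ∈ M, Q) := by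
      rw [← Finset.mul_sum]
      congr 1
      exact (measure_biUnion_finset hdisj fun Q hQ => hm Q (hMP Q hQ)).symm

/-- A finite laminar family is sparse (with constant `1 / 2`) for the measure `μ` if the members
properly contained in a member `Q` cover at most half of `Q`. -/
structure IsFinSparse (μ : Measure X) (P : Finset (Set X)) : Prop where
  measurableSet : ∀ Q ∈ P, MeasurableSet Q
  isLaminar : IsLaminar (P : Set (Set X))
  ne_zero : ∀ Q ∈ P, μ Q ≠ 0
  ne_top : ∀ Q ∈ P, μ Q ≠ ∞
  measure_le : ∀ Q ∈ P, 2 * μ (⋃ R ∈ {R | R ∈ P ∧ R ⊂ Q}, R) ≤ μ Q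

lemma IsFinSparse.mono {μ : Measure X} {P P' : Finset (Set X)} (h : IsFinSparse μ P)
    (hP : P' ⊆ P) : IsFinSparse μ P' where
  measurableSet Q hQ := h.measurableSet Q (hP hQ)
  isLaminar := h.isLaminar.mono (by exact_mod_cast hP)
  ne_zero Q hQ := h.ne_zero Q (hP hQ)
  ne_top Q hQ := h.ne_top Q (hP hQ)
  measure_le Q hQ := by
    refine le_trans ?_ (h.measure_le Q (hP hQ))
    exact mul_le_mul_right (measure_mono (Set.biUnion_subset_biUnion_left
      (s' := {R | R ∈ P ∧ R ⊂ Q}) fun R hR => ⟨hP hR.1, hR.2⟩)) _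

lemma IsFinSparse.measure_le_core {μ : Measure X} {P : Finset (Set X)} (h : IsFinSparse μ P)
    {Q : Set X} (hQ : Q ∈ P) : μ Q ≤ 2 * μ (core P Q) := by
  have hU : MeasurableSet (⋃ R ∈ {R | R ∈ P ∧ R ⊂ Q}, R) :=
    MeasurableSet.biUnion (countable_properSubsets P Q) fun R hR => h.measurableSet R hR.1
  have hsub := biUnion_properSubsets_subset P Q
  have h1 : μ (⋃ R ∈ {R | R ∈ P ∧ R ⊂ Q}, R) + μ (core P Q) = μ Q := by
    rw [core, measure_sdiff hsub hU.nullMeasurableSet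
      ((measure_mono hsub).trans_lt (h.ne_top Q hQ).lt_top).ne]
    exact add_tsub_cancel_of_le (measure_mono hsub)
  have h2 := h.measure_le Q hQ
  have h3 : μ Q + μ Q ≤ μ Q + 2 * μ (core P Q) := by
    calc μ Q + μ Q = 2 * μ (⋃ R ∈ {R | R ∈ P ∧ R ⊂ Q}, R) + 2 * μ (core P Q) := by
          rw [← mul_add, h1, two_mul]
      _ ≤ _ := by gcongr
  exact (ENNReal.add_le_add_iff_left (h.ne_top Q hQ)).1 h3

lemma sum_measure_core_le {P : Finset (Set X)} (hm : ∀ Q ∈ P, MeasurableSet Q)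
    (hP : IsLaminar (P : Set (Set X))) (μ : Measure X) :
    ∑ Q ∈ P, μ (core P Q) ≤ μ Set.univ := by
  rw [← measure_biUnion_finset (pairwiseDisjoint_core hP) fun Q hQ => measurableSet_core hm hQ]
  exact measure_mono (Set.subset_univ _)

/-- If the `λ`-densities `μ Q / λ Q` of the members of a sparse family all lie in `[s, 3 s / 2]`,
then every member keeps a quarter of its `μ`-mass on its core. Hence the sum of the `ν`-masses
costs only the constant `A` of `hA`, which is the `A₁` condition in integrated form. -/
lemma IsFinSparse.mul_sum_measure_le {lam μ ν σ : Measure X} {P : Finset (Set X)}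
    (h : IsFinSparse lam P) {A s : ℝ≥0∞} (hs : s ≠ ∞)
    (hA : ∀ Q ∈ P, ∀ E ⊆ Q, MeasurableSet E → μ E * ν Q ≤ A * lam Q * σ E)
    (hlow : ∀ Q ∈ P, s * lam Q ≤ μ Q) (hup : ∀ Q ∈ P, μ Q ≤ 3 / 2 * s * lam Q) :
    s * ∑ Q ∈ P, ν Q ≤ 4 * A * σ Set.univ := by
  classical
  have hfin : ∀ Q ∈ P, μ Q ≠ ∞ := fun Q hQ => ne_top_of_le_ne_top
    (ENNReal.mul_ne_top (ENNReal.mul_ne_top (by finiteness) hs) (h.ne_top Q hQ)) (hup Q hQ)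
  have hcore : ∀ Q ∈ P, μ Q ≤ 4 * μ (core P Q) := by
    intro Q hQ
    set U := ⋃ R ∈ {R | R ∈ P ∧ R ⊂ Q}, R with hUdef
    have hU : MeasurableSet U :=
      MeasurableSet.biUnion (countable_properSubsets P Q) fun R hR => h.measurableSet R hR.1
    have hsub : U ⊆ Q := biUnion_properSubsets_subset P Q
    have h1 : μ U + μ (core P Q) = μ Q := by
      rw [core, measure_sdiff hsub hU.nullMeasurableSet
        ((measure_mono hsub).trans_lt (hfin Q hQ).lt_top).ne]
      exact add_tsub_cancel_of_le (measure_mono hsub)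
    have hUP : U = ⋃ R ∈ P.filter (· ⊂ Q), R := by
      simp [hUdef]
    have h2 : μ U ≤ 3 / 2 * s * lam U := by
      rw [hUP]
      have hsubP : P.filter (· ⊂ Q) ⊆ P := Finset.filter_subset _ _
      exact measure_biUnion_le_of_isLaminar (fun R hR => h.measurableSet R (hsubP hR))
        (h.isLaminar.mono (by exact_mod_cast hsubP)) μ lam _ fun R hR => hup R (hsubP hR)
    have h3 : 4 * μ U ≤ 3 * μ Q := by
      calc 4 * μ U ≤ 4 * (3 / 2 * s * lam U) := by gcongr
        _ = 3 * (s * (2 * lam U)) * (2 / 2) := by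
          simp only [div_eq_mul_inv]; ring
        _ = 3 * (s * (2 * lam U)) := by
          rw [ENNReal.div_self (by norm_num) (by norm_num), mul_one]
        _ ≤ 3 * (s * lam Q) := by gcongr; exact h.measure_le Q hQ
        _ ≤ 3 * μ Q := by gcongr; exact hlow Q hQ
    have h4 : 3 * μ Q + μ Q ≤ 3 * μ Q + 4 * μ (core P Q) := by
      calc 3 * μ Q + μ Q = 4 * μ U + 4 * μ (core P Q) := by rw [← mul_add, h1]; ring
        _ ≤ _ := by gcongr
    exact (ENNReal.add_le_add_iff_left (ENNReal.mul_ne_top (by norm_num) (hfin Q hQ))).1 h4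
  have hterm : ∀ Q ∈ P, s * ν Q ≤ 4 * A * σ (core P Q) := by
    intro Q hQ
    have h0 := h.ne_zero Q hQ
    have ht := h.ne_top Q hQ
    refine (ENNReal.mul_le_mul_iff_right h0 ht).1 ?_
    calc lam Q * (s * ν Q) = (s * lam Q) * ν Q := by ring
      _ ≤ (4 * μ (core P Q)) * ν Q := mul_le_mul_left ((hlow Q hQ).trans (hcore Q hQ)) _
      _ = 4 * (μ (core P Q) * ν Q) := by ring
      _ ≤ 4 * (A * lam Q * σ (core P Q)) := by
        exact mul_le_mul_right
          (hA Q hQ _ (core_subset P Q) (measurableSet_core h.measurableSet hQ)) _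
      _ = _ := by ring
  calc s * ∑ Q ∈ P, ν Q = ∑ Q ∈ P, s * ν Q := Finset.mul_sum _ _ _
    _ ≤ ∑ Q ∈ P, 4 * A * σ (core P Q) := Finset.sum_le_sum hterm
    _ = 4 * A * ∑ Q ∈ P, σ (core P Q) := (Finset.mul_sum _ _ _).symm
    _ ≤ _ := by gcongr; exact sum_measure_core_le h.measurableSet h.isLaminar σ

/-- `P` satisfies the packing condition with constant `Λ` for the measure `ν`. -/
def IsCarleson (ν : Measure X) (Λ : ℝ≥0∞) (P : Finset (Set X)) : Prop :=
  ∀ Q ∈ P, ∀ P' ⊆ P, (∀ R ∈ P', R ⊆ Q) → ∑ R ∈ P', ν R ≤ Λ * ν Q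

lemma IsCarleson.mono {ν : Measure X} {Λ : ℝ≥0∞} {P P' : Finset (Set X)}
    (h : IsCarleson ν Λ P) (hP : P' ⊆ P) : IsCarleson ν Λ P' :=
  fun Q hQ P'' hP'' hR => h Q (hP hQ) P'' (hP''.trans hP) hR

lemma measurable_mult {P : Finset (Set X)} (hm : ∀ Q ∈ P, MeasurableSet Q) :
    Measurable (mult P) :=
  Finset.measurable_fun_sum _ fun Q hQ => measurable_one.indicator (hm Q hQ)

lemma lintegral_mult {P : Finset (Set X)} (hm : ∀ Q ∈ P, MeasurableSet Q) (ν : Measure X) :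
    ∫⁻ x, mult P x ∂ν = ∑ Q ∈ P, ν Q := by
  unfold mult
  rw [lintegral_finsetSum _ fun Q hQ => measurable_one.indicator (hm Q hQ)]
  exact Finset.sum_congr rfl fun Q hQ => lintegral_indicator_one (hm Q hQ)

open Classical in
/-- The packing condition controls all moments of the number of members through a point. -/
lemma lintegral_mult_pow_le {ν : Measure X} {Λ : ℝ≥0∞} (n : ℕ) {P : Finset (Set X)}
    (hm : ∀ Q ∈ P, MeasurableSet Q) (hP : IsLaminar (P : Set (Set X)))
    (hC : IsCarleson ν Λ P) :
    ∫⁻ x, mult P x ^ (n + 1) ∂ν ≤ (n + 1).factorial * Λ ^ n * ∑ Q ∈ P, ν Q := by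
  induction n generalizing P with
  | zero => simp [lintegral_mult hm]
  | succ n ih =>
    have hsub : ∀ Q : Set X, P.filter (· ⊆ Q) ⊆ P := fun Q => Finset.filter_subset _ _
    have hmQ : ∀ Q : Set X, ∀ R ∈ P.filter (· ⊆ Q), MeasurableSet R :=
      fun Q R hR => hm R (hsub Q hR)
    calc ∫⁻ x, mult P x ^ (n + 1 + 1) ∂ν
        ≤ ∫⁻ x, (((n + 1 : ℕ) : ℝ≥0∞) + 1) *
            ∑ Q ∈ P, mult (P.filter (· ⊆ Q)) x ^ (n + 1) ∂ν :=
          lintegral_mono fun x => mult_pow_succ_le hP (n + 1) x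
      _ = (((n + 1 : ℕ) : ℝ≥0∞) + 1) *
            ∑ Q ∈ P, ∫⁻ x, mult (P.filter (· ⊆ Q)) x ^ (n + 1) ∂ν := by
          rw [lintegral_const_mul _ (Finset.measurable_fun_sum _ fun Q _ =>
            (measurable_mult (hmQ Q)).pow_const _),
            lintegral_finsetSum _ fun Q _ => (measurable_mult (hmQ Q)).pow_const _]
      _ ≤ (((n + 1 : ℕ) : ℝ≥0∞) + 1) *
            ∑ Q ∈ P, (n + 1).factorial * Λ ^ n * (Λ * ν Q) := by
          refine mul_le_mul_right (Finset.sum_le_sum fun Q hQ => ?_) _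
          refine (ih (hmQ Q) (hP.mono (by exact_mod_cast hsub Q)) (hC.mono (hsub Q))).trans ?_
          exact mul_le_mul_right
            (hC Q hQ _ (hsub Q) fun R hR => (Finset.mem_filter.1 hR).2) _
      _ = (n + 1 + 1).factorial * Λ ^ (n + 1) * ∑ Q ∈ P, ν Q := by
          rw [← Finset.mul_sum, ← Finset.mul_sum, Nat.factorial_succ (n + 1)]
          push_cast
          ring

/-- Splitting according to whether a point lies in more than `Λ y` members, and the moment bound,
give a mass estimate relative to a set `E` with arbitrarily fast polynomial decay in `y`. -/
lemma IsCarleson.sum_measure_inter_le {ν : Measure X} {Λ y : ℝ≥0∞} (n : ℕ) {P : Finset (Set X)}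
    (hm : ∀ Q ∈ P, MeasurableSet Q) (hP : IsLaminar (P : Set (Set X))) (hC : IsCarleson ν Λ P)
    (hΛ : Λ ≠ 0) (hΛ' : Λ ≠ ∞) (hy : y ≠ 0) (hy' : y ≠ ∞) (E : Set X) :
    ∑ Q ∈ P, ν (Q ∩ E) ≤
      Λ * y * ν E + (n + 1).factorial * y⁻¹ ^ n * ∑ Q ∈ P, ν Q := by
  set u := Λ * y with hu
  have hu0 : u ≠ 0 := mul_ne_zero hΛ hy
  have hut : u ≠ ∞ := ENNReal.mul_ne_top hΛ' hy'
  have hpt : ∀ N : ℝ≥0∞, N ≤ u + u⁻¹ ^ n * N ^ (n + 1) := by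
    intro N
    rcases le_total N u with h | h
    · exact h.trans le_self_add
    · have h1 : 1 ≤ (u⁻¹ * N) ^ n := by
        refine one_le_pow₀ ?_
        rw [← ENNReal.inv_mul_cancel hu0 hut]
        gcongr
      calc N = 1 * N := (one_mul N).symm
        _ ≤ (u⁻¹ * N) ^ n * N := by gcongr
        _ = u⁻¹ ^ n * N ^ (n + 1) := by ring
        _ ≤ _ := le_add_self
  calc ∑ Q ∈ P, ν (Q ∩ E) = ∫⁻ x in E, mult P x ∂ν := by
        rw [lintegral_mult hm]
        exact Finset.sum_congr rfl fun Q hQ => (Measure.restrict_apply (hm Q hQ)).symm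
    _ ≤ ∫⁻ x in E, (u + u⁻¹ ^ n * mult P x ^ (n + 1)) ∂ν := lintegral_mono fun x => hpt _
    _ = u * ν E + ∫⁻ x in E, u⁻¹ ^ n * mult P x ^ (n + 1) ∂ν := by
        rw [lintegral_add_left measurable_const, setLIntegral_const]
    _ ≤ u * ν E + u⁻¹ ^ n * ∫⁻ x, mult P x ^ (n + 1) ∂ν := by
        rw [lintegral_const_mul _ ((measurable_mult hm).pow_const _)]
        gcongr
        exact Measure.restrict_le_self
    _ ≤ u * ν E + u⁻¹ ^ n * ((n + 1).factorial * Λ ^ n * ∑ Q ∈ P, ν Q) := by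
        gcongr
        exact lintegral_mult_pow_le n hm hP hC
    _ = _ := by
        have : u⁻¹ ^ n * Λ ^ n = y⁻¹ ^ n := by
          rw [← mul_pow, hu, ENNReal.mul_inv (Or.inl hΛ) (Or.inl hΛ'), mul_right_comm,
            ENNReal.inv_mul_cancel hΛ hΛ', one_mul]
        rw [← this]
        ring

end Laminar

/-! ### The sparse form over a laminar family -/

section

/-- The loss from summing over the levels of a sparse family with packing constant `Λ`:
`Λ ^ (1 / p - 1) (1 + log Λ)` for `p ≤ 1`, and `1` for `p > 1`. -/
noncomputable def levelFactor (p Λ : ℝ) : ℝ :=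
  if p ≤ 1 then Λ ^ (1 / p - 1) * (1 + Real.log Λ) else 1

lemma one_le_levelFactor {p Λ : ℝ} (hp : 0 < p) (hΛ : 1 ≤ Λ) : 1 ≤ levelFactor p Λ := by
  unfold levelFactor
  split_ifs with h
  · have h1 : 1 ≤ Λ ^ (1 / p - 1) := Real.one_le_rpow hΛ (by
      have := one_le_one_div hp h
      linarith)
    have h2 := Real.log_nonneg hΛ
    nlinarith
  · exact le_rfl

lemma tsum_ofReal_pow_le {a : ℝ} (h0 : 0 ≤ a) (h1 : a < 1) :
    ∑' k : ℕ, ENNReal.ofReal (a ^ k) = ENNReal.ofReal (1 / (1 - a)) := by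
  rw [← ENNReal.ofReal_tsum_of_nonneg (fun k => pow_nonneg h0 k)
    (summable_geometric_of_lt_one h0 h1), tsum_geometric_of_lt_one h0 h1, one_div]

lemma exists_level_coefficients_of_one_lt {p : ℝ} (hp : 1 < p) :
    ∃ C : ℝ, 0 < C ∧
      ∑' k : ℕ, ENNReal.ofReal ((2 / 3 : ℝ) ^ ((k : ℝ) * p - (k + 1))) ≤ ENNReal.ofReal C := by
  have h1 : (2 / 3 : ℝ) ^ (p - 1) < 1 := Real.rpow_lt_one (by norm_num) (by norm_num) (by linarith)
  have h0 : 0 < (2 / 3 : ℝ) ^ (p - 1) := by positivity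
  refine ⟨3 / 2 * (1 / (1 - (2 / 3 : ℝ) ^ (p - 1))), ?_, ?_⟩
  · have : 0 < 1 - (2 / 3 : ℝ) ^ (p - 1) := by linarith
    positivity
  · rw [ENNReal.ofReal_mul (by norm_num), ← tsum_ofReal_pow_le h0.le h1, ← ENNReal.tsum_mul_left]
    refine ENNReal.tsum_le_tsum fun k => le_of_eq ?_
    rw [← ENNReal.ofReal_mul (by norm_num), ← Real.rpow_mul_natCast (by norm_num),
      show (k : ℝ) * p - (k + 1) = (p - 1) * k + (-1) by ring, Real.rpow_add (by norm_num),
      Real.rpow_neg_one]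
    norm_num [mul_comm]

/-- The choice of parameters for `p ≤ 1`. Below the level `K`, where `(3 / 2) ^ (K p)` is about
`Λ`, the trivial bound is used; at the level `K + i` the bound of
`IsCarleson.sum_measure_inter_le` is used with `y = (3 / 2) ^ (i p / 2)`. -/
lemma exists_level_coefficients_of_le_one {p : ℝ} (hp : 0 < p) (hp1 : p ≤ 1) :
    ∃ (C₁ C₂ : ℝ) (n : ℕ), 0 < C₁ ∧ 0 < C₂ ∧ ∀ Λ : ℝ, 1 ≤ Λ → ∃ K : ℕ,
      (∑' i : ℕ, ENNReal.ofReal ((2 / 3 : ℝ) ^ (((K + i : ℕ) : ℝ) * p)) *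
        (ENNReal.ofReal Λ * ENNReal.ofReal ((3 / 2 : ℝ) ^ ((i : ℝ) * p / 2)))
          ≤ ENNReal.ofReal C₁) ∧
      (∑ k ∈ Finset.range K, ENNReal.ofReal ((2 / 3 : ℝ) ^ ((k : ℝ) * p - (k + 1))) +
        ∑' i : ℕ, ENNReal.ofReal ((2 / 3 : ℝ) ^ (((K + i : ℕ) : ℝ) * p - ((K + i : ℕ) + 1))) *
          ((n + 1).factorial * (ENNReal.ofReal ((3 / 2 : ℝ) ^ ((i : ℝ) * p / 2)))⁻¹ ^ n)
          ≤ ENNReal.ofReal (C₂ * levelFactor p Λ)) := by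
  -- With `n p / 2 ≥ 2`, the decay `y ^ (-n)` beats the growth `b ^ (i (1 - p))` by at least a
  -- factor `b ^ i`, where `b = 3 / 2` and `y = b ^ (i p / 2)`.
  obtain ⟨n, hn⟩ := exists_nat_ge (4 / p)
  have hnp : 4 ≤ n * p := by rwa [div_le_iff₀ hp] at hn
  set b : ℝ := 3 / 2 with hb
  have hc : (2 / 3 : ℝ) = b⁻¹ := by norm_num [hb]
  have hb0 : 0 < b := by norm_num [hb]
  have hb1 : 1 < b := by norm_num [hb]
  have hlb : 0 < Real.log b := Real.log_pos hb1
  have hρ0 : 0 < (b ^ (-(p / 2)) : ℝ) := by positivity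
  have hρ1 : (b ^ (-(p / 2)) : ℝ) < 1 := Real.rpow_lt_one_of_one_lt_of_neg hb1 (by linarith)
  refine ⟨1 / (1 - b ^ (-(p / 2))),
    b ^ (2 - p) * (1 + 1 / (p * Real.log b) + 3 * (n + 1).factorial), n, ?_, by positivity, ?_⟩
  · have : 0 < 1 - (b ^ (-(p / 2)) : ℝ) := by linarith
    positivity
  intro Λ hΛ
  have hΛ0 : 0 < Λ := by linarith
  have hlΛ : 0 ≤ Real.log Λ := Real.log_nonneg hΛ
  set z := Real.log Λ / (p * Real.log b) with hz
  have hz0 : 0 ≤ z := by positivity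
  have hbz : b ^ z = Λ ^ (1 / p) := by
    rw [Real.rpow_def_of_pos hb0, Real.rpow_def_of_pos hΛ0, hz]
    congr 1
    field_simp
  set K := ⌈z⌉₊
  have hK1 : z ≤ K := Nat.le_ceil z
  have hK2 : (K : ℝ) ≤ z + 1 := (Nat.ceil_lt_add_one hz0).le
  have hpow : ∀ u : ℝ, (2 / 3 : ℝ) ^ u = b ^ (-u) := fun u => by
    rw [hc, Real.inv_rpow hb0.le, Real.rpow_neg hb0.le]
  have hKΛ : Λ ≤ b ^ ((K : ℝ) * p) := by
    calc Λ = (Λ ^ (1 / p)) ^ p := by rw [← Real.rpow_mul hΛ0.le]; field_simp; simp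
      _ = b ^ (z * p) := by rw [← hbz, Real.rpow_mul hb0.le]
      _ ≤ _ := Real.rpow_le_rpow_of_exponent_le hb1.le (by nlinarith)
  have hKb : b ^ ((K : ℝ) * (1 - p) + 1) ≤ b ^ (2 - p) * Λ ^ (1 / p - 1) := by
    have h1 : Λ ^ (1 / p - 1) = b ^ (z * (1 - p)) := by
      rw [Real.rpow_mul hb0.le, hbz, ← Real.rpow_mul hΛ0.le]
      congr 1
      field_simp
    rw [h1, ← Real.rpow_add hb0]
    exact Real.rpow_le_rpow_of_exponent_le hb1.le (by nlinarith)
  have hKl : (K : ℝ) ≤ (1 + 1 / (p * Real.log b)) * (1 + Real.log Λ) := by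
    have : z = 1 / (p * Real.log b) * Real.log Λ := by rw [hz]; ring
    have h2 : 0 < 1 / (p * Real.log b) := by positivity
    nlinarith
  refine ⟨K, ?_, ?_⟩
  · rw [← tsum_ofReal_pow_le hρ0.le hρ1]
    refine ENNReal.tsum_le_tsum fun i => ?_
    rw [← ENNReal.ofReal_mul hΛ0.le, ← ENNReal.ofReal_mul (by positivity)]
    refine ENNReal.ofReal_le_ofReal ?_
    calc (2 / 3 : ℝ) ^ (((K + i : ℕ) : ℝ) * p) * (Λ * b ^ ((i : ℝ) * p / 2))
        ≤ (2 / 3 : ℝ) ^ (((K + i : ℕ) : ℝ) * p) *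
            (b ^ ((K : ℝ) * p) * b ^ ((i : ℝ) * p / 2)) := by gcongr
      _ = (b ^ (-(p / 2))) ^ i := by
        rw [hpow, ← Real.rpow_add hb0, ← Real.rpow_add hb0, ← Real.rpow_mul_natCast hb0.le]
        congr 1
        push_cast
        ring
  · set D := b ^ ((K : ℝ) * (1 - p) + 1) with hD
    have hD0 : 0 < D := by positivity
    have hlow : ∑ k ∈ Finset.range K, ENNReal.ofReal ((2 / 3 : ℝ) ^ ((k : ℝ) * p - (k + 1)))
        ≤ ENNReal.ofReal (D * K) := by
      calc _ ≤ ∑ k ∈ Finset.range K, ENNReal.ofReal D := by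
            refine Finset.sum_le_sum fun k hk => ENNReal.ofReal_le_ofReal ?_
            rw [hpow]
            refine Real.rpow_le_rpow_of_exponent_le hb1.le ?_
            have : (k : ℝ) ≤ K := by exact_mod_cast (Finset.mem_range.1 hk).le
            nlinarith
        _ = _ := by
            rw [Finset.sum_const, Finset.card_range, nsmul_eq_mul, mul_comm,
              ENNReal.ofReal_mul hD0.le, ENNReal.ofReal_natCast]
    have hhigh : ∑' i : ℕ,
        ENNReal.ofReal ((2 / 3 : ℝ) ^ (((K + i : ℕ) : ℝ) * p - ((K + i : ℕ) + 1))) *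
          ((n + 1).factorial * (ENNReal.ofReal (b ^ ((i : ℝ) * p / 2)))⁻¹ ^ n)
        ≤ ENNReal.ofReal (D * (3 * (n + 1).factorial)) := by
      have h3 : (3 : ℝ) = 1 / (1 - 2 / 3) := by norm_num
      rw [show D * (3 * ((n + 1).factorial : ℝ)) = D * (n + 1).factorial * (1 / (1 - 2 / 3)) by
        rw [← h3]; ring, ENNReal.ofReal_mul (by positivity),
        ← tsum_ofReal_pow_le (by norm_num) (by norm_num), ← ENNReal.tsum_mul_left]
      refine ENNReal.tsum_le_tsum fun i => ?_
      rw [← ENNReal.ofReal_inv_of_pos (by positivity), ← ENNReal.ofReal_pow (by positivity),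
        ← ENNReal.ofReal_natCast, ← ENNReal.ofReal_mul (by positivity),
        ← ENNReal.ofReal_mul (by positivity), ← ENNReal.ofReal_mul (by positivity)]
      refine ENNReal.ofReal_le_ofReal ?_
      have h4 : (2 / 3 : ℝ) ^ (((K + i : ℕ) : ℝ) * p - ((K + i : ℕ) + 1)) *
          (b ^ ((i : ℝ) * p / 2))⁻¹ ^ n ≤ D * (2 / 3) ^ i := by
        rw [← Real.rpow_neg hb0.le, ← Real.rpow_mul_natCast hb0.le, ← Real.rpow_natCast (2 / 3),
          hpow, hpow, hD, ← Real.rpow_add hb0, ← Real.rpow_add hb0]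
        refine Real.rpow_le_rpow_of_exponent_le hb1.le ?_
        push_cast
        have : (0 : ℝ) ≤ i := Nat.cast_nonneg i
        nlinarith
      calc _ = (n + 1).factorial * ((2 / 3 : ℝ) ^ (((K + i : ℕ) : ℝ) * p - ((K + i : ℕ) + 1)) *
          (b ^ ((i : ℝ) * p / 2))⁻¹ ^ n) := by ring
        _ ≤ (n + 1).factorial * (D * (2 / 3) ^ i) := by gcongr
        _ = _ := by ring
    refine (add_le_add hlow hhigh).trans ?_
    rw [← ENNReal.ofReal_add (by positivity) (by positivity), ← mul_add]
    refine ENNReal.ofReal_le_ofReal ?_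
    rw [levelFactor, if_pos hp1]
    have hf : (0 : ℝ) < 3 * (n + 1).factorial := by positivity
    calc D * (K + 3 * (n + 1).factorial)
        ≤ (b ^ (2 - p) * Λ ^ (1 / p - 1)) *
          ((1 + 1 / (p * Real.log b)) * (1 + Real.log Λ) +
            3 * (n + 1).factorial * (1 + Real.log Λ)) := by
          refine mul_le_mul hKb (add_le_add hKl ?_) (by positivity) (by positivity)
          nlinarith [mul_nonneg hf.le hlΛ]
      _ = _ := by ring

variable {X : Type*} [MeasurableSpace X]

open Classical in
/-- The members of `P` whose density `μ Q / lam Q` is comparable to `t (2 / 3) ^ k`. -/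
noncomputable def level (lam μ : Measure X) (P : Finset (Set X)) (t : ℝ) (k : ℕ) :
    Finset (Set X) :=
  P.filter fun Q => ENNReal.ofReal (t * (2 / 3) ^ (k + 1)) ≤ μ Q / lam Q ∧
    μ Q / lam Q ≤ ENNReal.ofReal (t * (2 / 3) ^ k)

lemma level_subset (lam μ : Measure X) (P : Finset (Set X)) (t : ℝ) (k : ℕ) :
    level lam μ P t k ⊆ P := Finset.filter_subset _ _

lemma exists_level {t : ℝ} (ht : 0 < t) {x : ℝ≥0∞} (hx0 : x ≠ 0) (hxt : x ≤ ENNReal.ofReal t) :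
    ∃ k : ℕ, ENNReal.ofReal (t * (2 / 3) ^ (k + 1)) ≤ x ∧
      x ≤ ENNReal.ofReal (t * (2 / 3) ^ k) := by
  have hxtop : x ≠ ∞ := ne_top_of_le_ne_top ENNReal.ofReal_ne_top hxt
  lift x to ℝ≥0 using hxtop
  have hx : (0 : ℝ) < x := by
    have : x ≠ 0 := by exact_mod_cast hx0
    positivity
  have hxt' : (x : ℝ) ≤ t := by
    rw [← ENNReal.ofReal_coe_nnreal] at hxt
    exact (ENNReal.ofReal_le_ofReal_iff ht.le).1 hxt
  obtain ⟨k, hk1, hk2⟩ := exists_nat_pow_near (x := t / x) (y := (3 / 2 : ℝ))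
    ((one_le_div hx).2 hxt') (by norm_num)
  have hinv : ∀ m : ℕ, (2 / 3 : ℝ) ^ m * (3 / 2) ^ m = 1 := fun m => by
    rw [← mul_pow]; norm_num
  rw [le_div_iff₀ hx] at hk1
  rw [div_lt_iff₀ hx] at hk2
  refine ⟨k, ?_, ?_⟩
  · rw [← ENNReal.ofReal_coe_nnreal]
    refine ENNReal.ofReal_le_ofReal ?_
    calc t * (2 / 3) ^ (k + 1) ≤ ((3 / 2) ^ (k + 1) * x) * (2 / 3) ^ (k + 1) := by gcongr
      _ = ((2 / 3 : ℝ) ^ (k + 1) * (3 / 2) ^ (k + 1)) * x := by ring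
      _ = x := by rw [hinv, one_mul]
  · rw [← ENNReal.ofReal_coe_nnreal]
    refine ENNReal.ofReal_le_ofReal ?_
    calc (x : ℝ) = ((2 / 3 : ℝ) ^ k * (3 / 2) ^ k) * x := by rw [hinv, one_mul]
      _ = ((3 / 2) ^ k * x) * (2 / 3) ^ k := by ring
      _ ≤ _ := by gcongr

lemma sum_le_tsum_level {lam μ ν : Measure X} {P : Finset (Set X)} {p t : ℝ} {E : Set X}
    (hp : 0 < p) (ht : 0 < t) (h0 : ∀ Q ∈ P, lam Q ≠ 0) (h0' : ∀ Q ∈ P, lam Q ≠ ∞)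
    (hE : ∀ Q ∈ P, ν (Q ∩ E) ≠ 0 → μ Q ≤ ENNReal.ofReal t * lam Q) :
    ∑ Q ∈ P, (μ Q / lam Q) ^ p * ν (Q ∩ E) ≤
      ∑' k : ℕ, ENNReal.ofReal (t * (2 / 3) ^ k) ^ p *
        ∑ Q ∈ level lam μ P t k, ν (Q ∩ E) := by
  classical
  simp only [level, Finset.sum_filter, Finset.mul_sum]
  rw [Summable.tsum_finsetSum fun _ _ => ENNReal.summable]
  refine Finset.sum_le_sum fun Q hQ => ?_
  by_cases hν : ν (Q ∩ E) = 0
  · simp [hν]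
  by_cases hx : μ Q / lam Q = 0
  · simp [hx, hp]
  obtain ⟨k, hk⟩ := exists_level ht hx
    ((ENNReal.div_le_iff (h0 Q hQ) (h0' Q hQ)).2 (hE Q hQ hν))
  refine le_trans ?_ (ENNReal.le_tsum k)
  rw [if_pos hk]
  gcongr
  exact hk.2

lemma IsFinSparse.sum_level_le {lam μ ν σ : Measure X} {P : Finset (Set X)}
    (h : IsFinSparse lam P) {A : ℝ≥0∞} {t : ℝ} (ht : 0 < t)
    (hA : ∀ Q ∈ P, ∀ E ⊆ Q, MeasurableSet E → μ E * ν Q ≤ A * lam Q * σ E) (k : ℕ) :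
    ∑ Q ∈ level lam μ P t k, ν Q ≤
      ENNReal.ofReal (t * (2 / 3) ^ (k + 1))⁻¹ * (4 * A * σ Set.univ) := by
  have hsub := level_subset lam μ P t k
  have hs : 0 < t * (2 / 3 : ℝ) ^ (k + 1) := by positivity
  have h1 := (h.mono hsub).mul_sum_measure_le (μ := μ) (ν := ν) (σ := σ) (A := A)
    (s := ENNReal.ofReal (t * (2 / 3) ^ (k + 1))) ENNReal.ofReal_ne_top
    (fun Q hQ => hA Q (hsub hQ))
    (fun Q hQ => (ENNReal.le_div_iff_mul_le (Or.inl (h.ne_zero Q (hsub hQ)))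
      (Or.inl (h.ne_top Q (hsub hQ)))).1 (Finset.mem_filter.1 hQ).2.1)
    (fun Q hQ => by
      have h2 := (ENNReal.div_le_iff (h.ne_zero Q (hsub hQ)) (h.ne_top Q (hsub hQ))).1
        (Finset.mem_filter.1 hQ).2.2
      refine h2.trans (mul_le_mul_left (le_of_eq ?_) _)
      rw [show (3 / 2 : ℝ≥0∞) = ENNReal.ofReal (3 / 2) by
        rw [ENNReal.ofReal_div_of_pos (by norm_num)]; norm_num,
        ← ENNReal.ofReal_mul (by norm_num)]
      congr 1
      ring)
  rw [ENNReal.ofReal_inv_of_pos hs, ← ENNReal.div_eq_inv_mul]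
  rw [ENNReal.le_div_iff_mul_le (Or.inl (by simpa using hs)) (Or.inl ENNReal.ofReal_ne_top),
    mul_comm]
  exact h1

lemma level_weight_eq {t : ℝ} (ht : 0 < t) (p : ℝ) (k : ℕ) :
    ENNReal.ofReal (t * (2 / 3) ^ k) ^ p =
      ENNReal.ofReal (t ^ p) * ENNReal.ofReal ((2 / 3 : ℝ) ^ ((k : ℝ) * p)) := by
  rw [ENNReal.ofReal_rpow_of_pos (by positivity), ← ENNReal.ofReal_mul (by positivity),
    Real.mul_rpow ht.le (by positivity), Real.rpow_mul (by norm_num) (k : ℝ) p, Real.rpow_natCast]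

lemma level_weight_mul_inv {t : ℝ} (ht : 0 < t) (p : ℝ) (k : ℕ) :
    ENNReal.ofReal (t * (2 / 3) ^ k) ^ p * ENNReal.ofReal (t * (2 / 3) ^ (k + 1))⁻¹ =
      ENNReal.ofReal (t ^ (p - 1)) *
        ENNReal.ofReal ((2 / 3 : ℝ) ^ ((k : ℝ) * p - (k + 1))) := by
  rw [level_weight_eq ht, ← ENNReal.ofReal_mul (by positivity),
    ← ENNReal.ofReal_mul (by positivity), ← ENNReal.ofReal_mul (by positivity)]
  congr 1
  have : ((2 / 3 : ℝ)) ^ ((k : ℝ) * p - (k + 1)) =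
      (2 / 3 : ℝ) ^ ((k : ℝ) * p) * ((2 / 3) ^ (k + 1))⁻¹ := by
    rw [Real.rpow_sub (by norm_num), div_eq_mul_inv]
    norm_cast
  rw [this, Real.rpow_sub_one ht.ne', mul_inv]
  ring

lemma IsFinSparse.level_term_le {lam μ ν σ : Measure X} {P : Finset (Set X)}
    (hP : IsFinSparse lam P) {A Λ y : ℝ≥0∞} {t : ℝ} (ht : 0 < t) (p : ℝ)
    (hCar : IsCarleson ν Λ P)
    (hA : ∀ Q ∈ P, ∀ E ⊆ Q, MeasurableSet E → μ E * ν Q ≤ A * lam Q * σ E)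
    (hΛ : Λ ≠ 0) (hΛ' : Λ ≠ ∞) (hy : y ≠ 0) (hy' : y ≠ ∞) (E : Set X) (n k : ℕ) :
    ENNReal.ofReal (t * (2 / 3) ^ k) ^ p * ∑ Q ∈ level lam μ P t k, ν (Q ∩ E) ≤
      ENNReal.ofReal ((2 / 3 : ℝ) ^ ((k : ℝ) * p)) * (Λ * y) * (ENNReal.ofReal (t ^ p) * ν E) +
      ENNReal.ofReal ((2 / 3 : ℝ) ^ ((k : ℝ) * p - (k + 1))) * ((n + 1).factorial * y⁻¹ ^ n) *
        (ENNReal.ofReal (t ^ (p - 1)) * (4 * A * σ Set.univ)) := by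
  have hsub := level_subset lam μ P t k
  have hB := (hCar.mono hsub).sum_measure_inter_le n
    (fun Q hQ => hP.measurableSet Q (hsub hQ))
    (hP.isLaminar.mono (by exact_mod_cast hsub)) hΛ hΛ' hy hy' E
  have hS := hP.sum_level_le ht hA k
  have h1 := level_weight_mul_inv ht p k
  have h2 := level_weight_eq ht p k
  generalize ∑ Q ∈ level lam μ P t k, ν Q = S at hB hS
  generalize ENNReal.ofReal (t * (2 / 3) ^ (k + 1))⁻¹ = s at h1 hS
  generalize 4 * A * σ Set.univ = Z at hS ⊢
  generalize ENNReal.ofReal (t * (2 / 3) ^ k) ^ p = x at h1 h2 ⊢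
  calc x * ∑ Q ∈ level lam μ P t k, ν (Q ∩ E)
      ≤ x * (Λ * y * ν E + (n + 1).factorial * y⁻¹ ^ n * (s * Z)) :=
        mul_le_mul_right (hB.trans (add_le_add_right (mul_le_mul_right hS _) _)) _
    _ = x * (Λ * y * ν E) + (x * s) * ((n + 1).factorial * y⁻¹ ^ n * Z) := by ring
    _ = _ := by
      rw [h1, h2]
      ring

/-- The estimate of the sparse form: the sum over a sparse family, tested against the restriction
of `ν` to a set `E` that meets (up to null sets) only members of density at most `t`. -/
theorem exists_sparse_sum_bound {p : ℝ} (hp : 0 < p) :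
    ∃ C₁ C₂ : ℝ, 0 < C₁ ∧ 0 < C₂ ∧ ∀ (lam μ ν σ : Measure X) (P : Finset (Set X)) (A : ℝ≥0∞)
      (Λ t : ℝ) (E : Set X), IsFinSparse lam P → 1 ≤ Λ → 0 < t →
      IsCarleson ν (ENNReal.ofReal Λ) P →
      (∀ Q ∈ P, ∀ E ⊆ Q, MeasurableSet E → μ E * ν Q ≤ A * lam Q * σ E) →
      (∀ Q ∈ P, ν (Q ∩ E) ≠ 0 → μ Q ≤ ENNReal.ofReal t * lam Q) →
      ∑ Q ∈ P, (μ Q / lam Q) ^ p * ν (Q ∩ E) ≤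
        ENNReal.ofReal (C₁ * t ^ p) * ν E +
          ENNReal.ofReal (C₂ * levelFactor p Λ * t ^ (p - 1)) * (A * σ Set.univ) := by
  have htriv : ∀ (lam μ ν σ : Measure X) (P : Finset (Set X)) (A : ℝ≥0∞)
      (t : ℝ) (E : Set X), IsFinSparse lam P → 0 < t →
      (∀ Q ∈ P, ∀ E ⊆ Q, MeasurableSet E → μ E * ν Q ≤ A * lam Q * σ E) → ∀ k : ℕ,
      ENNReal.ofReal (t * (2 / 3) ^ k) ^ p * ∑ Q ∈ level lam μ P t k, ν (Q ∩ E) ≤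
        ENNReal.ofReal ((2 / 3 : ℝ) ^ ((k : ℝ) * p - (k + 1))) *
          (ENNReal.ofReal (t ^ (p - 1)) * (4 * A * σ Set.univ)) := by
    intro lam μ ν σ P A t E hP ht hA k
    calc _ ≤ ENNReal.ofReal (t * (2 / 3) ^ k) ^ p *
          (ENNReal.ofReal (t * (2 / 3) ^ (k + 1))⁻¹ * (4 * A * σ Set.univ)) := by
          gcongr
          exact (Finset.sum_le_sum fun Q _ => measure_mono Set.inter_subset_left).trans
            (hP.sum_level_le ht hA k)
      _ = _ := by
          rw [← mul_assoc, level_weight_mul_inv ht]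
          ring
  rcases lt_or_ge 1 p with hp1 | hp1
  · obtain ⟨C, hC, hsum⟩ := exists_level_coefficients_of_one_lt hp1
    refine ⟨1, 4 * C, one_pos, by positivity, ?_⟩
    intro lam μ ν σ P A Λ t E hP hΛ ht hCar hA hE
    refine (sum_le_tsum_level hp ht hP.ne_zero hP.ne_top hE).trans (le_trans ?_ le_add_self)
    refine (ENNReal.tsum_le_tsum (htriv lam μ ν σ P A t E hP ht hA)).trans ?_
    rw [ENNReal.tsum_mul_right, levelFactor, if_neg hp1.not_ge, mul_one]
    refine (mul_le_mul_left hsum _).trans (le_of_eq ?_)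
    rw [ENNReal.ofReal_mul (by positivity), ENNReal.ofReal_mul (by norm_num : (0 : ℝ) ≤ 4)]
    norm_num
    ring
  · obtain ⟨C₁, C₂, n, hC₁, hC₂, hcoef⟩ := exists_level_coefficients_of_le_one hp hp1
    refine ⟨C₁, 4 * C₂, hC₁, by positivity, ?_⟩
    intro lam μ ν σ P A Λ t E hP hΛ ht hCar hA hE
    obtain ⟨K, hα, hβ⟩ := hcoef Λ hΛ
    have hΛ0 : 0 < Λ := by linarith
    refine (sum_le_tsum_level hp ht hP.ne_zero hP.ne_top hE).trans ?_
    set a : ℕ → ℝ≥0∞ := fun k => ENNReal.ofReal (t * (2 / 3) ^ k) ^ p *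
      ∑ Q ∈ level lam μ P t k, ν (Q ∩ E)
    set Z := ENNReal.ofReal (t ^ (p - 1)) * (4 * A * σ Set.univ) with hZ
    have hlow : ∀ k : ℕ, a k ≤
        ENNReal.ofReal ((2 / 3 : ℝ) ^ ((k : ℝ) * p - (k + 1))) * Z :=
      htriv lam μ ν σ P A t E hP ht hA
    have hhigh : ∀ i : ℕ, a (K + i) ≤
        ENNReal.ofReal ((2 / 3 : ℝ) ^ (((K + i : ℕ) : ℝ) * p)) *
          (ENNReal.ofReal Λ * ENNReal.ofReal ((3 / 2 : ℝ) ^ ((i : ℝ) * p / 2))) *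
            (ENNReal.ofReal (t ^ p) * ν E) +
        ENNReal.ofReal ((2 / 3 : ℝ) ^ (((K + i : ℕ) : ℝ) * p - ((K + i : ℕ) + 1))) *
          ((n + 1).factorial * (ENNReal.ofReal ((3 / 2 : ℝ) ^ ((i : ℝ) * p / 2)))⁻¹ ^ n) * Z := by
      intro i
      have hy : 0 < (3 / 2 : ℝ) ^ ((i : ℝ) * p / 2) := by positivity
      exact hP.level_term_le ht p hCar hA (by simpa using hΛ0) ENNReal.ofReal_ne_top
        (by simpa using hy) ENNReal.ofReal_ne_top E n (K + i)
    have hcomb : ∀ s α β x z c₁ c₂ : ℝ≥0∞, α ≤ c₁ → s + β ≤ c₂ →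
        s * z + (α * x + β * z) ≤ c₁ * x + c₂ * z := by
      intro s α β x z c₁ c₂ h₁ h₂
      calc _ = α * x + (s + β) * z := by ring
        _ ≤ _ := by gcongr
    clear_value a
    calc ∑' k, a k = ∑ k ∈ Finset.range K, a k + ∑' i, a (K + i) := by
          rw [← (ENNReal.summable (f := fun i => a (i + K))).sum_add_tsum_nat_add']
          simp only [add_comm K]
      _ ≤ (∑ k ∈ Finset.range K, ENNReal.ofReal ((2 / 3 : ℝ) ^ ((k : ℝ) * p - (k + 1)))) * Z +
          ((∑' i : ℕ, ENNReal.ofReal ((2 / 3 : ℝ) ^ (((K + i : ℕ) : ℝ) * p)) *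
            (ENNReal.ofReal Λ * ENNReal.ofReal ((3 / 2 : ℝ) ^ ((i : ℝ) * p / 2)))) *
              (ENNReal.ofReal (t ^ p) * ν E) +
          (∑' i : ℕ,
            ENNReal.ofReal ((2 / 3 : ℝ) ^ (((K + i : ℕ) : ℝ) * p - ((K + i : ℕ) + 1))) *
            ((n + 1).factorial *
              (ENNReal.ofReal ((3 / 2 : ℝ) ^ ((i : ℝ) * p / 2)))⁻¹ ^ n)) * Z) := by
          rw [Finset.sum_mul, ← ENNReal.tsum_mul_right, ← ENNReal.tsum_mul_right,
            ← ENNReal.tsum_add]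
          exact add_le_add (Finset.sum_le_sum fun k _ => hlow k)
            (ENNReal.tsum_le_tsum hhigh)
      _ ≤ ENNReal.ofReal C₁ * (ENNReal.ofReal (t ^ p) * ν E) +
          ENNReal.ofReal (C₂ * levelFactor p Λ) * Z := by
          exact hcomb _ _ _ _ _ _ _ hα hβ
      _ = _ := by
          have hl : 0 ≤ levelFactor p Λ := by linarith [one_le_levelFactor hp hΛ]
          rw [hZ, ENNReal.ofReal_mul hC₁.le,
            ENNReal.ofReal_mul (by positivity : 0 ≤ 4 * C₂ * levelFactor p Λ), mul_assoc 4 C₂,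
            ENNReal.ofReal_mul (by norm_num : (0 : ℝ) ≤ 4)]
          norm_num
          ring

end

/-! ### Dyadic grids -/

section

variable {d : ℕ}

lemma IsCube.measurableSet {Q : Set (Fin d → ℝ)} (hQ : IsCube Q) : MeasurableSet Q := by
  obtain ⟨a, l, -, rfl⟩ := hQ
  exact MeasurableSet.univ_pi fun i => measurableSet_Ico

lemma IsCube.volume_ne_zero {Q : Set (Fin d → ℝ)} (hQ : IsCube Q) : volume Q ≠ 0 := by
  obtain ⟨a, l, hl, rfl⟩ := hQ
  simp [volume_pi_pi, Real.volume_Ico, hl]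

lemma IsCube.volume_ne_top {Q : Set (Fin d → ℝ)} (hQ : IsCube Q) : volume Q ≠ ∞ := by
  obtain ⟨a, l, hl, rfl⟩ := hQ
  simp [volume_pi_pi, Real.volume_Ico]

/-- The cube of generation `j` and position `k` in the grid with shift `α / 3`. -/
def dyadicCube (α : Fin d → Fin 3) (j : ℤ) (k : Fin d → ℤ) : Set (Fin d → ℝ) :=
  Set.univ.pi fun i =>
    Set.Ico ((2 : ℝ) ^ (-j) * ((-1 : ℝ) ^ j * (((α i : ℕ) : ℝ) / 3) + (k i : ℝ)))
      ((2 : ℝ) ^ (-j) * ((-1 : ℝ) ^ j * (((α i : ℕ) : ℝ) / 3) + (k i : ℝ) + 1))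

lemma isCube_dyadicCube (α : Fin d → Fin 3) (j : ℤ) (k : Fin d → ℤ) :
    IsCube (dyadicCube α j k) := by
  refine ⟨fun i => (2 : ℝ) ^ (-j) * ((-1 : ℝ) ^ j * (((α i : ℕ) : ℝ) / 3) + (k i : ℝ)),
    (2 : ℝ) ^ (-j), by positivity, ?_⟩
  refine congrArg (Set.pi Set.univ) (funext fun i => ?_)
  rw [mul_add _ (_ + _) 1, mul_one]

lemma mem_dyadicGrid {α : Fin d → Fin 3} {Q : Set (Fin d → ℝ)} :
    Q ∈ dyadicGrid α ↔ ∃ j k, Q = dyadicCube α j k := Iff.rfl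

lemma isCube_of_mem_dyadicGrid {α : Fin d → Fin 3} {Q : Set (Fin d → ℝ)}
    (hQ : Q ∈ dyadicGrid α) : IsCube Q := by
  obtain ⟨j, k, rfl⟩ := mem_dyadicGrid.1 hQ
  exact isCube_dyadicCube α j k

lemma countable_dyadicGrid (α : Fin d → Fin 3) : (dyadicGrid α).Countable := by
  have : dyadicGrid α = Set.range fun jk : ℤ × (Fin d → ℤ) => dyadicCube α jk.1 jk.2 := by
    ext Q
    simp only [mem_dyadicGrid, Set.mem_range, Prod.exists]
    exact ⟨fun ⟨j, k, h⟩ => ⟨j, k, h.symm⟩, fun ⟨j, k, h⟩ => ⟨j, k, h.symm⟩⟩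
  rw [this]
  exact Set.countable_range _

/-- The shifts of two consecutive generations are compatible because `2 ^ m ≡ (-1) ^ m` modulo
`3`, so an interval of a finer generation lies in every coarser one that it meets. -/
lemma Ico_subset_of_mem_dyadic (a : ℕ) (j k k' : ℤ) (m : ℕ) {x : ℝ}
    (h : x ∈ Set.Ico ((2 : ℝ) ^ (-j) * ((-1 : ℝ) ^ j * ((a : ℝ) / 3) + (k : ℝ)))
      ((2 : ℝ) ^ (-j) * ((-1 : ℝ) ^ j * ((a : ℝ) / 3) + (k : ℝ) + 1)))
    (h' : x ∈ Set.Ico ((2 : ℝ) ^ (-(j + m)) * ((-1 : ℝ) ^ (j + m) * ((a : ℝ) / 3) + (k' : ℝ)))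
      ((2 : ℝ) ^ (-(j + m)) * ((-1 : ℝ) ^ (j + m) * ((a : ℝ) / 3) + (k' : ℝ) + 1))) :
    Set.Ico ((2 : ℝ) ^ (-(j + m)) * ((-1 : ℝ) ^ (j + m) * ((a : ℝ) / 3) + (k' : ℝ)))
      ((2 : ℝ) ^ (-(j + m)) * ((-1 : ℝ) ^ (j + m) * ((a : ℝ) / 3) + (k' : ℝ) + 1)) ⊆
    Set.Ico ((2 : ℝ) ^ (-j) * ((-1 : ℝ) ^ j * ((a : ℝ) / 3) + (k : ℝ)))
      ((2 : ℝ) ^ (-j) * ((-1 : ℝ) ^ j * ((a : ℝ) / 3) + (k : ℝ) + 1)) := by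
  obtain ⟨c, hc⟩ : (3 : ℤ) ∣ 2 ^ m - (-1) ^ m := by
    have := sub_dvd_pow_sub_pow (2 : ℤ) (-1) m
    norm_num at this
    exact this
  obtain ⟨e, he⟩ : ∃ e : ℤ, (-1 : ℝ) ^ j = e := by
    rcases Int.even_or_odd j with h | h
    · exact ⟨1, by rw [h.neg_one_zpow]; simp⟩
    · exact ⟨-1, by rw [h.neg_one_zpow]; simp⟩
  have hcR : (2 : ℝ) ^ m = (-1) ^ m + 3 * c := by
    have : ((2 ^ m - (-1) ^ m : ℤ) : ℝ) = ((3 * c : ℤ) : ℝ) := by rw [hc]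
    push_cast at this
    linarith
  have h2 : (2 : ℝ) ^ (-j) = (2 : ℝ) ^ (-(j + m)) * 2 ^ m := by
    rw [← zpow_natCast, ← zpow_add₀ (by norm_num)]
    congr 1
    ring
  have hs : (0 : ℝ) < (2 : ℝ) ^ (-(j + m)) := by positivity
  set s := (2 : ℝ) ^ (-(j + m))
  have h1 : (-1 : ℝ) ^ (j + (m : ℤ)) = e * (-1) ^ m := by
    rw [zpow_add₀ (by norm_num), he, zpow_natCast]
  set A' : ℝ := (-1 : ℝ) ^ (j + (m : ℤ)) * ((a : ℝ) / 3) + (k' : ℝ) with hA'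
  set z : ℤ := e * c * a + 2 ^ m * k - k' with hz
  have hA : (2 : ℝ) ^ m * ((-1 : ℝ) ^ j * ((a : ℝ) / 3) + (k : ℝ)) = A' + z := by
    rw [hA', h1, he, hz]
    push_cast
    have : (2 : ℝ) ^ m * (e * (a / 3) + k) = ((-1) ^ m + 3 * c) * (e * (a / 3)) + 2 ^ m * k := by
      rw [← hcR]; ring
    rw [this]
    ring
  have hlow : (2 : ℝ) ^ (-j) * ((-1 : ℝ) ^ j * ((a : ℝ) / 3) + (k : ℝ)) = s * (A' + z) := by
    rw [h2, mul_assoc, hA]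
  have hup : (2 : ℝ) ^ (-j) * ((-1 : ℝ) ^ j * ((a : ℝ) / 3) + (k : ℝ) + 1) =
      s * (A' + z + 2 ^ m) := by
    rw [h2, mul_assoc, mul_add, hA, mul_one]
  rw [hlow, hup] at h ⊢
  have hz0 : (z : ℝ) < 1 := by
    have := lt_of_mul_lt_mul_left (h.1.trans_lt h'.2) hs.le
    linarith
  have hz1 : (0 : ℝ) < z + 2 ^ m := by
    have := lt_of_mul_lt_mul_left (h'.1.trans_lt h.2) hs.le
    linarith
  have hz0' : z ≤ 0 := by
    have : z < 1 := by exact_mod_cast hz0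
    omega
  have hz1' : 1 ≤ z + 2 ^ m := by
    have : 0 < z + 2 ^ m := by exact_mod_cast hz1
    omega
  have hz0R : (z : ℝ) ≤ 0 := by exact_mod_cast hz0'
  have hz1R : (1 : ℝ) ≤ z + 2 ^ m := by exact_mod_cast hz1'
  exact Set.Ico_subset_Ico (mul_le_mul_of_nonneg_left (by linarith) hs.le)
    (mul_le_mul_of_nonneg_left (by linarith) hs.le)

lemma dyadicCube_subset {α : Fin d → Fin 3} {j j' : ℤ} (hj : j ≤ j') {k k' : Fin d → ℤ}
    (h : ¬ Disjoint (dyadicCube α j k) (dyadicCube α j' k')) :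
    dyadicCube α j' k' ⊆ dyadicCube α j k := by
  obtain ⟨x, hx, hx'⟩ := Set.not_disjoint_iff.1 h
  obtain ⟨m, rfl⟩ := Int.le.dest hj
  intro y hy i _
  exact Ico_subset_of_mem_dyadic (α i) j (k i) (k' i) m (hx i trivial) (hx' i trivial)
    (hy i trivial)

lemma nonempty_dyadicCube (α : Fin d → Fin 3) (j : ℤ) (k : Fin d → ℤ) :
    (dyadicCube α j k).Nonempty := by
  by_contra h
  rw [Set.not_nonempty_iff_eq_empty] at h
  exact (isCube_dyadicCube α j k).volume_ne_zero (by rw [h]; exact measure_empty)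

lemma isLaminar_dyadicGrid (α : Fin d → Fin 3) : IsLaminar (dyadicGrid α) := by
  intro Q hQ R hR
  obtain ⟨j, k, rfl⟩ := mem_dyadicGrid.1 hQ
  obtain ⟨j', k', rfl⟩ := mem_dyadicGrid.1 hR
  by_cases h : Disjoint (dyadicCube α j k) (dyadicCube α j' k')
  · exact Or.inr (Or.inr h)
  rcases le_total j j' with hj | hj
  · exact Or.inr (Or.inl (dyadicCube_subset hj h))
  · exact Or.inl (dyadicCube_subset hj fun h' => h h'.symm)

/-- Within a dyadic grid, the cubes between two given ones have bounded generation; hence maximal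
cubes exist. -/
lemma exists_subset_children {α : Fin d → Fin 3} {F : Set (Set (Fin d → ℝ))}
    (hF : F ⊆ dyadicGrid α) {Q R : Set (Fin d → ℝ)} (hQ : Q ∈ F) (hR : R ∈ F) (hRQ : R ⊂ Q) :
    ∃ Q' ∈ children F Q, R ⊆ Q' := by
  obtain ⟨jQ, kQ, rfl⟩ := mem_dyadicGrid.1 (hF hQ)
  let p : ℤ → Prop := fun j => ∃ k, dyadicCube α j k ∈ F ∧
    dyadicCube α j k ⊂ dyadicCube α jQ kQ ∧ R ⊆ dyadicCube α j k
  have hbdd : ∀ j, p j → jQ ≤ j := by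
    rintro j ⟨k, -, h, -⟩
    by_contra! hlt
    refine h.not_subset (dyadicCube_subset hlt.le fun hd => ?_)
    obtain ⟨x, hx⟩ := nonempty_dyadicCube α j k
    exact Set.disjoint_left.1 hd hx (h.subset hx)
  have hex : ∃ j, p j := by
    obtain ⟨j, k, rfl⟩ := mem_dyadicGrid.1 (hF hR)
    exact ⟨j, k, hR, hRQ, subset_rfl⟩
  obtain ⟨j, ⟨k, hkF, hkQ, hRk⟩, hmin⟩ := Int.exists_least_of_bdd ⟨jQ, hbdd⟩ hex
  refine ⟨_, ⟨⟨hkF, hkQ⟩, ?_⟩, hRk⟩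
  rintro S ⟨hSF, hSQ⟩ hS
  replace hS : dyadicCube α j k ⊆ S := hS
  obtain ⟨j', k', rfl⟩ := mem_dyadicGrid.1 (hF hSF)
  have hj : j ≤ j' := hmin j' ⟨k', hSF, hSQ, hRk.trans hS⟩
  refine dyadicCube_subset hj fun hd => ?_
  obtain ⟨x, hx⟩ := nonempty_dyadicCube α j k
  exact Set.disjoint_left.1 hd hx (hS hx)

/-- Finite parts of a sparse collection are sparse in the measure-theoretic sense: the properly
contained cubes are covered by the maximal ones. -/
lemma isFinSparse_of_subset {α : Fin d → Fin 3} {F : Set (Set (Fin d → ℝ))}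
    (hF : F ⊆ dyadicGrid α)
    (hS : ∀ Q ∈ F, ∑' Q' : children F Q, volume (Q' : Set (Fin d → ℝ)) ≤
      ENNReal.ofReal (1 - 1 / 2) * volume Q)
    {P : Finset (Set (Fin d → ℝ))} (hP : ∀ Q ∈ P, Q ∈ F) : IsFinSparse volume P where
  measurableSet Q hQ := (isCube_of_mem_dyadicGrid (hF (hP Q hQ))).measurableSet
  isLaminar := (isLaminar_dyadicGrid α).mono fun Q hQ => hF (hP Q hQ)
  ne_zero Q hQ := (isCube_of_mem_dyadicGrid (hF (hP Q hQ))).volume_ne_zero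
  ne_top Q hQ := (isCube_of_mem_dyadicGrid (hF (hP Q hQ))).volume_ne_top
  measure_le Q hQ := by
    have hcount : (children F Q).Countable :=
      (countable_dyadicGrid α).mono fun R hR => hF hR.1.1
    have hsub : (⋃ R ∈ {R | R ∈ P ∧ R ⊂ Q}, R) ⊆ ⋃ R ∈ children F Q, R := by
      refine Set.iUnion₂_subset fun R hR => ?_
      obtain ⟨Q', hQ', hRQ'⟩ := exists_subset_children hF (hP Q hQ) (hP R hR.1) hR.2
      exact hRQ'.trans (Set.subset_biUnion_of_mem (u := id) hQ')
    calc 2 * volume (⋃ R ∈ {R | R ∈ P ∧ R ⊂ Q}, R)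
        ≤ 2 * ∑' Q' : children F Q, volume (Q' : Set (Fin d → ℝ)) := by
          gcongr
          exact (measure_mono hsub).trans (measure_biUnion_le _ hcount _)
      _ ≤ 2 * (ENNReal.ofReal (1 - 1 / 2) * volume Q) := by gcongr; exact hS Q (hP Q hQ)
      _ = volume Q := by
          rw [← mul_assoc, show (2 : ℝ≥0∞) = ENNReal.ofReal 2 by simp,
            ← ENNReal.ofReal_mul (by norm_num)]
          norm_num

end

/-! ### Muckenhoupt weights and packing -/

section

variable {d : ℕ}

/-- The measure `v dx`. -/
noncomputable def weightMeasure (v : (Fin d → ℝ) → ℝ) : Measure (Fin d → ℝ) :=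
  volume.withDensity fun x => ENNReal.ofReal (v x)

lemma weightMeasure_apply (v : (Fin d → ℝ) → ℝ) {E : Set (Fin d → ℝ)} (hE : MeasurableSet E) :
    weightMeasure v E = ∫⁻ x in E, ENNReal.ofReal (v x) := withDensity_apply _ hE

lemma weightMass_eq (v : (Fin d → ℝ) → ℝ) {E : Set (Fin d → ℝ)} (hE : MeasurableSet E) :
    weightMass v E = weightMeasure v E := (weightMeasure_apply v hE).symm

lemma avg_one_eq {F : Type*} [NormedAddCommGroup F] (Q : Set (Fin d → ℝ))
    (f : (Fin d → ℝ) → F) : avg 1 Q f = (volume Q)⁻¹ * ∫⁻ x in Q, ‖f x‖ₑ := by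
  rw [avg, eLpNorm_one_eq_lintegral_enorm, lintegral_smul_measure, smul_eq_mul]

lemma IsWeight.enorm_ae_eq {v : (Fin d → ℝ) → ℝ} (hv : IsWeight v) :
    (fun x => ‖v x‖ₑ) =ᵐ[volume] fun x => ENNReal.ofReal (v x) := by
  filter_upwards [hv.2] with x hx
  exact Real.enorm_of_nonneg hx.le

lemma IsWeight.avg_one {v : (Fin d → ℝ) → ℝ} (hv : IsWeight v) {Q : Set (Fin d → ℝ)}
    (hQ : IsCube Q) : avg 1 Q v = (volume Q)⁻¹ * weightMeasure v Q := by
  rw [avg_one_eq, weightMeasure_apply v hQ.measurableSet,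
    lintegral_congr_ae (ae_restrict_of_ae hv.enorm_ae_eq)]

lemma IsWeight.one_le_mul {v : (Fin d → ℝ) → ℝ} (hv : IsWeight v) {Q : Set (Fin d → ℝ)}
    (hQ : IsCube Q) :
    ∀ᵐ x ∂volume.restrict Q, 1 ≤ avg ∞ Q (fun x => (v x)⁻¹) * ENNReal.ofReal (v x) := by
  have h1 : ∀ᵐ x ∂((volume Q)⁻¹ • volume.restrict Q),
      ‖(v x)⁻¹‖ₑ ≤ avg ∞ Q (fun x => (v x)⁻¹) := by
    rw [avg, eLpNorm_exponent_top]
    exact ae_le_eLpNormEssSup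
  have h2 : ∀ᵐ x ∂volume.restrict Q, ‖(v x)⁻¹‖ₑ ≤ avg ∞ Q (fun x => (v x)⁻¹) := by
    rwa [Measure.ae_ennreal_smul_measure_eq (ENNReal.inv_ne_zero.2 hQ.volume_ne_top)] at h1
  filter_upwards [h2, ae_restrict_of_ae hv.2] with x hx hpos
  rw [enorm_inv hpos.ne', Real.enorm_of_nonneg hpos.le] at hx
  have h0 : ENNReal.ofReal (v x) ≠ 0 := by simpa using hpos
  calc 1 = (ENNReal.ofReal (v x))⁻¹ * ENNReal.ofReal (v x) :=
        (ENNReal.inv_mul_cancel h0 ENNReal.ofReal_ne_top).symm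
    _ ≤ _ := by gcongr

lemma le_A1const (v : (Fin d → ℝ) → ℝ) {Q : Set (Fin d → ℝ)} (hQ : IsCube Q) :
    avg 1 Q v * avg ∞ Q (fun x => (v x)⁻¹) ≤ A1const v :=
  le_iSup₂_of_le (f := fun Q (_ : IsCube Q) => avg 1 Q v * avg ∞ Q (fun x => (v x)⁻¹)) Q hQ le_rfl

/-- The `A₁` condition in integrated form: the mean of `v` over `Q` is at most `[v]₁` times the
value of `v` almost everywhere on `Q`. -/
lemma IsWeight.lintegral_mul_weightMeasure_le {v : (Fin d → ℝ) → ℝ} (hv : IsWeight v)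
    {Q E : Set (Fin d → ℝ)} (hQ : IsCube Q) (hE : E ⊆ Q) (h : (Fin d → ℝ) → ℝ≥0∞)
    (hh : AEMeasurable h) :
    (∫⁻ x in E, h x) * weightMeasure v Q ≤
      A1const v * volume Q * ∫⁻ x in E, ENNReal.ofReal (v x) * h x := by
  set s := avg ∞ Q (fun x => (v x)⁻¹)
  have h1 : ∫⁻ x in E, h x ≤ s * ∫⁻ x in E, ENNReal.ofReal (v x) * h x := by
    rw [← lintegral_const_mul'' _ (hv.1.ennreal_ofReal.fun_mul hh).restrict]
    refine lintegral_mono_ae ?_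
    filter_upwards [ae_mono (Measure.restrict_mono_set volume hE) (hv.one_le_mul hQ)] with x hx
    calc h x = 1 * h x := (one_mul _).symm
      _ ≤ (s * ENNReal.ofReal (v x)) * h x := by gcongr
      _ = _ := mul_assoc _ _ _
  have h2 : weightMeasure v Q * s ≤ A1const v * volume Q := by
    have := le_A1const v hQ
    rw [hv.avg_one hQ] at this
    calc weightMeasure v Q * s = (volume Q * (volume Q)⁻¹) * (weightMeasure v Q * s) := by
          rw [ENNReal.mul_inv_cancel hQ.volume_ne_zero hQ.volume_ne_top, one_mul]
      _ = ((volume Q)⁻¹ * weightMeasure v Q * s) * volume Q := by ring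
      _ ≤ _ := by gcongr
  calc _ ≤ (s * ∫⁻ x in E, ENNReal.ofReal (v x) * h x) * weightMeasure v Q := by gcongr
    _ = (weightMeasure v Q * s) * ∫⁻ x in E, ENNReal.ofReal (v x) * h x := by ring
    _ ≤ _ := by gcongr

lemma IsA1.weightMeasure_ne_top {v : (Fin d → ℝ) → ℝ} (hv : IsA1 v) {Q : Set (Fin d → ℝ)}
    (hQ : IsCube Q) : weightMeasure v Q ≠ ∞ := by
  intro htop
  have h1 := (le_A1const v hQ).trans_lt hv.2
  have hs : avg ∞ Q (fun x => (v x)⁻¹) ≠ 0 := by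
    intro h0
    have h2 := hv.1.one_le_mul hQ
    simp only [h0, zero_mul, nonpos_iff_eq_zero, one_ne_zero, Filter.eventually_false_iff_eq_bot,
      ae_eq_bot, Measure.restrict_eq_zero] at h2
    exact hQ.volume_ne_zero h2
  rw [hv.1.avg_one hQ, htop, ENNReal.mul_top (ENNReal.inv_ne_zero.2 hQ.volume_ne_top),
    ENNReal.top_mul hs] at h1
  exact lt_irrefl _ h1

lemma IsWeight.weightMeasure_ne_zero {v : (Fin d → ℝ) → ℝ} (hv : IsWeight v)
    {Q : Set (Fin d → ℝ)} (hQ : IsCube Q) : weightMeasure v Q ≠ 0 := by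
  intro h0
  have := hv.one_le_mul hQ
  rw [weightMeasure_apply v hQ.measurableSet, lintegral_eq_zero_iff' hv.1.ennreal_ofReal.restrict]
    at h0
  have h2 : ∀ᵐ x ∂volume.restrict Q, False := by
    filter_upwards [this, h0] with x h1 h2
    simp [show ENNReal.ofReal (v x) = 0 from h2] at h1
  simp only [Filter.eventually_false_iff_eq_bot, ae_eq_bot, Measure.restrict_eq_zero] at h2
  exact hQ.volume_ne_zero h2

lemma sum_lintegral_core_le {X : Type*} [MeasurableSpace X] {P : Finset (Set X)}
    (hm : ∀ Q ∈ P, MeasurableSet Q) (hP : IsLaminar (P : Set (Set X))) (μ : Measure X)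
    (g : X → ℝ≥0∞) {Q : Set X} (hQ : ∀ R ∈ P, R ⊆ Q) :
    ∑ R ∈ P, ∫⁻ x in core P R, g x ∂μ ≤ ∫⁻ x in Q, g x ∂μ := by
  rw [← lintegral_biUnion_finset (pairwiseDisjoint_core hP) fun Q hQ => measurableSet_core hm hQ]
  exact lintegral_mono_set (Set.iUnion₂_subset fun R hR => (core_subset P R).trans (hQ R hR))

/-- By the `A₁` condition, `v(R)` is at most `2 [v]₁` times the mass of the core of `R`, and the
cores are disjoint. -/
lemma IsWeight.isCarleson_A1const {v : (Fin d → ℝ) → ℝ} (hv : IsWeight v)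
    {P : Finset (Set (Fin d → ℝ))} (hP : IsFinSparse volume P) (hcube : ∀ Q ∈ P, IsCube Q) :
    IsCarleson (weightMeasure v) (2 * A1const v) P := by
  intro Q hQ P' hP' hsub
  have hPP := hP.mono hP'
  have hterm : ∀ R ∈ P', weightMeasure v R ≤
      2 * A1const v * ∫⁻ x in core P' R, ENNReal.ofReal (v x) := by
    intro R hR
    have hc := hcube R (hP' hR)
    have h1 := hv.lintegral_mul_weightMeasure_le hc (core_subset P' R) (fun _ => 1)
      aemeasurable_const
    simp only [lintegral_const, Measure.restrict_apply_univ, one_mul, mul_one] at h1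
    refine (ENNReal.mul_le_mul_iff_right hc.volume_ne_zero hc.volume_ne_top).1 ?_
    calc volume R * weightMeasure v R ≤ (2 * volume (core P' R)) * weightMeasure v R :=
          mul_le_mul_left (hPP.measure_le_core hR) _
      _ = 2 * (volume (core P' R) * weightMeasure v R) := by ring
      _ ≤ 2 * (A1const v * volume R * ∫⁻ x in core P' R, ENNReal.ofReal (v x)) :=
          mul_le_mul_right h1 _
      _ = _ := by ring
  calc _ ≤ ∑ R ∈ P', 2 * A1const v * ∫⁻ x in core P' R, ENNReal.ofReal (v x) :=
        Finset.sum_le_sum hterm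
    _ ≤ 2 * A1const v * ∫⁻ x in Q, ENNReal.ofReal (v x) := by
        rw [← Finset.mul_sum]
        exact mul_le_mul_right
          (sum_lintegral_core_le hPP.measurableSet hPP.isLaminar volume _ hsub) _
    _ = _ := by rw [weightMeasure_apply v (hP.measurableSet Q hQ)]

lemma IsWeight.le_maximalFn {v : (Fin d → ℝ) → ℝ} (hv : IsWeight v) {Q R : Set (Fin d → ℝ)}
    (hR : IsCube R) (hRQ : R ⊆ Q) {x : Fin d → ℝ} (hx : x ∈ R) :
    (volume R)⁻¹ * weightMeasure v R ≤ maximalFn (Q.indicator v) x := by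
  have h1 : avg 1 R (Q.indicator v) = (volume R)⁻¹ * weightMeasure v R := by
    rw [← hv.avg_one hR, avg_one_eq, avg_one_eq]
    congr 1
    refine setLIntegral_congr_fun hR.measurableSet fun y hy => ?_
    simp only [Set.indicator_of_mem (hRQ hy)]
  refine le_iSup₂_of_le
    (f := fun R (_ : IsCube R) => R.indicator (fun _ => avg 1 R (Q.indicator v)) x) R hR ?_
  rw [Set.indicator_of_mem hx, h1]

lemma IsA1.lintegral_maximalFn_le {v : (Fin d → ℝ) → ℝ} (hv : IsA1 v) {Q : Set (Fin d → ℝ)}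
    (hQ : IsCube Q) :
    ∫⁻ x in Q, maximalFn (Q.indicator v) x ≤ FWconst v * weightMeasure v Q := by
  have h1 : (weightMass v Q)⁻¹ * ∫⁻ x in Q, maximalFn (Q.indicator v) x ≤ FWconst v :=
    le_iSup₂_of_le (f := fun Q (_ : IsCube Q) =>
      (weightMass v Q)⁻¹ * ∫⁻ x in Q, maximalFn (Q.indicator v) x) Q hQ le_rfl
  rw [weightMass_eq v hQ.measurableSet] at h1
  have h0 := hv.1.weightMeasure_ne_zero hQ
  have ht := hv.weightMeasure_ne_top hQ
  calc _ = (weightMeasure v Q * (weightMeasure v Q)⁻¹) *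
        ∫⁻ x in Q, maximalFn (Q.indicator v) x := by
        rw [ENNReal.mul_inv_cancel h0 ht, one_mul]
    _ = ((weightMeasure v Q)⁻¹ * ∫⁻ x in Q, maximalFn (Q.indicator v) x) *
        weightMeasure v Q := by ring
    _ ≤ _ := by gcongr

/-- On the core of `R ⊆ Q` the maximal function of `v 1_Q` is at least the mean of `v` over `R`, and
the cores are disjoint. -/
lemma IsA1.isCarleson_FWconst {v : (Fin d → ℝ) → ℝ} (hv : IsA1 v)
    {P : Finset (Set (Fin d → ℝ))} (hP : IsFinSparse volume P) (hcube : ∀ Q ∈ P, IsCube Q) :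
    IsCarleson (weightMeasure v) (2 * FWconst v) P := by
  intro Q hQ P' hP' hsub
  have hPP := hP.mono hP'
  have hterm : ∀ R ∈ P', weightMeasure v R ≤
      2 * ∫⁻ x in core P' R, maximalFn (Q.indicator v) x := by
    intro R hR
    have hc := hcube R (hP' hR)
    have h2 : (volume R)⁻¹ * weightMeasure v R * volume (core P' R) ≤
        ∫⁻ x in core P' R, maximalFn (Q.indicator v) x := by
      rw [← setLIntegral_const]
      exact setLIntegral_mono' (measurableSet_core hPP.measurableSet hR) fun x hx =>
        hv.1.le_maximalFn hc (hsub R hR) (core_subset P' R hx)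
    calc weightMeasure v R = volume R * ((volume R)⁻¹ * weightMeasure v R) := by
          rw [← mul_assoc, ENNReal.mul_inv_cancel hc.volume_ne_zero hc.volume_ne_top, one_mul]
      _ ≤ (2 * volume (core P' R)) * ((volume R)⁻¹ * weightMeasure v R) :=
          mul_le_mul_left (hPP.measure_le_core hR) _
      _ = 2 * ((volume R)⁻¹ * weightMeasure v R * volume (core P' R)) := by ring
      _ ≤ _ := mul_le_mul_right h2 _
  calc _ ≤ ∑ R ∈ P', 2 * ∫⁻ x in core P' R, maximalFn (Q.indicator v) x :=
        Finset.sum_le_sum hterm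
    _ ≤ 2 * ∫⁻ x in Q, maximalFn (Q.indicator v) x := by
        rw [← Finset.mul_sum]
        exact mul_le_mul_right
          (sum_lintegral_core_le hPP.measurableSet hPP.isLaminar volume _ hsub) _
    _ ≤ 2 * (FWconst v * weightMeasure v Q) :=
        mul_le_mul_right (hv.lintegral_maximalFn_le (hcube Q hQ)) _
    _ = _ := by ring

lemma isCube_Ico (n : ℕ) :
    IsCube (Set.univ.pi fun _ : Fin d => Set.Ico (-((n : ℝ) + 1)) (n + 1)) := by
  refine ⟨fun _ => -((n : ℝ) + 1), 2 * (n + 1), by positivity, ?_⟩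
  refine congrArg (Set.pi Set.univ) (funext fun i => ?_)
  congr 1
  ring

lemma IsA1.one_le_FWconst {v : (Fin d → ℝ) → ℝ} (hv : IsA1 v) : 1 ≤ FWconst v := by
  have hQ := isCube_Ico (d := d) 0
  set Q : Set (Fin d → ℝ) := Set.univ.pi fun _ => Set.Ico (-(((0 : ℕ) : ℝ) + 1)) ((0 : ℕ) + 1)
  have h1 : weightMeasure v Q ≤ FWconst v * weightMeasure v Q := by
    refine le_trans ?_ (hv.lintegral_maximalFn_le hQ)
    calc weightMeasure v Q = ∫⁻ _ in Q, (volume Q)⁻¹ * weightMeasure v Q := by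
          rw [setLIntegral_const, mul_right_comm,
            ENNReal.inv_mul_cancel hQ.volume_ne_zero hQ.volume_ne_top, one_mul]
      _ ≤ _ := setLIntegral_mono' hQ.measurableSet fun x hx =>
          hv.1.le_maximalFn hQ subset_rfl hx
  refine (ENNReal.mul_le_mul_iff_left (hv.1.weightMeasure_ne_zero hQ)
    (hv.weightMeasure_ne_top hQ)).1 ?_
  rwa [one_mul]

end

/-! ### Dyadic maximal function and the sparse form -/

section

variable {d : ℕ}

lemma measure_biUnion_le_of_forall_finset {X : Type*} [MeasurableSpace X] {μ : Measure X}
    {𝓠 : Set (Set X)} (h𝓠 : 𝓠.Countable) {c : ℝ≥0∞}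
    (h : ∀ P : Finset (Set X), (∀ Q ∈ P, Q ∈ 𝓠) → μ (⋃ Q ∈ P, Q) ≤ c) :
    μ (⋃ Q ∈ 𝓠, Q) ≤ c := by
  classical
  have : Countable 𝓠 := h𝓠
  rw [Set.biUnion_eq_iUnion, Set.iUnion_eq_iUnion_finset, Directed.measure_iUnion]
  · refine iSup_le fun s => ?_
    have h1 := h (s.map (Function.Embedding.subtype _)) fun Q hQ => by
      obtain ⟨Q', -, rfl⟩ := Finset.mem_map.1 hQ
      exact Q'.2
    rwa [← Finset.set_biUnion_coe, Finset.coe_map, Set.biUnion_image] at h1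
  · exact directed_of_isDirected_le fun s t hst => Set.biUnion_subset_biUnion_left hst

/-- The union of the dyadic cubes on which the average of `h` exceeds `τ`. -/
def dyadicSuperlevel (α : Fin d → Fin 3) (h : (Fin d → ℝ) → ℝ≥0∞) (τ : ℝ≥0∞) :
    Set (Fin d → ℝ) :=
  ⋃ Q ∈ {Q | Q ∈ dyadicGrid α ∧ τ * volume Q < ∫⁻ x in Q, h x}, Q

lemma measurableSet_dyadicSuperlevel (α : Fin d → Fin 3) (h : (Fin d → ℝ) → ℝ≥0∞) (τ : ℝ≥0∞) :
    MeasurableSet (dyadicSuperlevel α h τ) :=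
  MeasurableSet.biUnion ((countable_dyadicGrid α).mono fun _ hQ => hQ.1)
    fun _ hQ => (isCube_of_mem_dyadicGrid hQ.1).measurableSet

/-- The weighted weak type `(1, 1)` inequality for the dyadic maximal operator and `v ∈ A₁`. -/
lemma IsWeight.weightMeasure_dyadicSuperlevel_le {v : (Fin d → ℝ) → ℝ} (hv : IsWeight v)
    {h : (Fin d → ℝ) → ℝ≥0∞} (hh : AEMeasurable h) (α : Fin d → Fin 3) {τ : ℝ≥0∞}
    (hτ : τ ≠ 0) (hτ' : τ ≠ ∞) :
    weightMeasure v (dyadicSuperlevel α h τ) ≤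
      τ⁻¹ * (A1const v * ∫⁻ x, ENNReal.ofReal (v x) * h x) := by
  set σ : Measure (Fin d → ℝ) :=
    volume.withDensity fun x => ENNReal.ofReal (v x) * h x with hσ
  refine measure_biUnion_le_of_forall_finset
    ((countable_dyadicGrid α).mono fun _ hQ => hQ.1) fun P hP => ?_
  have hc : ∀ Q ∈ P, IsCube Q := fun Q hQ => isCube_of_mem_dyadicGrid (hP Q hQ).1
  have hle := measure_biUnion_le_of_isLaminar (fun Q hQ => (hc Q hQ).measurableSet)
    ((isLaminar_dyadicGrid α).mono fun Q hQ => (hP Q hQ).1) (weightMeasure v) σ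
    (τ⁻¹ * A1const v) fun Q hQ => by
      have h1 := hv.lintegral_mul_weightMeasure_le (hc Q hQ) subset_rfl h hh
      rw [← withDensity_apply (fun x => ENNReal.ofReal (v x) * h x) (hc Q hQ).measurableSet,
        ← hσ] at h1
      have h0 := (hc Q hQ).volume_ne_zero
      have ht := (hc Q hQ).volume_ne_top
      refine (ENNReal.mul_le_mul_iff_right h0 ht).1 ((ENNReal.mul_le_mul_iff_right hτ hτ').1 ?_)
      calc τ * (volume Q * weightMeasure v Q) = (τ * volume Q) * weightMeasure v Q := by ring
        _ ≤ (∫⁻ x in Q, h x) * weightMeasure v Q := mul_le_mul_left (hP Q hQ).2.le _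
        _ ≤ A1const v * volume Q * σ Q := h1
        _ = (τ * τ⁻¹) * (A1const v * volume Q * σ Q) := by
          rw [ENNReal.mul_inv_cancel hτ hτ', one_mul]
        _ = _ := by ring
  refine hle.trans ?_
  rw [mul_assoc]
  gcongr
  refine (measure_mono (Set.subset_univ _)).trans (le_of_eq ?_)
  rw [hσ, withDensity_apply _ MeasurableSet.univ, Measure.restrict_univ]

lemma IsSparse.tsum_le {S : Set (Set (Fin d → ℝ))} (hS : IsSparse (1 / 2) S)
    (φ : Set (Fin d → ℝ) → ℝ≥0∞) {B : ℝ≥0∞}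
    (h : ∀ α : Fin d → Fin 3, ∀ P : Finset (Set (Fin d → ℝ)), IsFinSparse volume P →
      (∀ Q ∈ P, Q ∈ dyadicGrid α) → ∑ Q ∈ P, φ Q ≤ B) :
    ∑' Q : S, φ Q ≤ 3 ^ d * B := by
  obtain ⟨F, rfl, hF⟩ := hS
  calc ∑' Q : ⋃ α, F α, φ Q ≤ ∑ α, ∑' Q : F α, φ Q := ENNReal.tsum_iUnion_le φ F
    _ ≤ ∑ _α : Fin d → Fin 3, B := by
      refine Finset.sum_le_sum fun α _ => ?_
      rw [ENNReal.tsum_eq_iSup_sum]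
      refine iSup_le fun s => ?_
      have hmem : ∀ Q ∈ s.map (Function.Embedding.subtype _), Q ∈ F α := by
        intro Q hQ
        obtain ⟨Q', -, rfl⟩ := Finset.mem_map.1 hQ
        exact Q'.2
      have := h α (s.map (Function.Embedding.subtype _))
        (isFinSparse_of_subset (hF α).1 (hF α).2 hmem) fun Q hQ => (hF α).1 (hmem Q hQ)
      rwa [Finset.sum_map] at this
    _ = 3 ^ d * B := by simp

lemma avg_rpow_eq {F : Type*} [NormedAddCommGroup F] {r : ℝ} (hr : 0 < r) (q : ℝ)
    (Q : Set (Fin d → ℝ)) (f : (Fin d → ℝ) → F) :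
    avg (ENNReal.ofReal r) Q f ^ q = ((∫⁻ x in Q, ‖f x‖ₑ ^ r) / volume Q) ^ (q / r) := by
  rw [avg, eLpNorm_eq_lintegral_rpow_enorm_toReal (by simpa using hr) ENNReal.ofReal_ne_top,
    ENNReal.toReal_ofReal hr.le, lintegral_smul_measure, smul_eq_mul, ← ENNReal.rpow_mul,
    ← ENNReal.div_eq_inv_mul]
  congr 1
  ring

lemma conjExponent_top_div {q : ℝ} : ENNReal.conjExponent (∞ / ENNReal.ofReal q) = 1 := by
  rw [ENNReal.top_div_of_ne_top ENNReal.ofReal_ne_top, ENNReal.conjExponent]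
  simp

variable {𝕜 : Type*} [RCLike 𝕜]

lemma IsWeight.enorm_indicator_ae_eq {v : (Fin d → ℝ) → ℝ} (hv : IsWeight v)
    (E : Set (Fin d → ℝ)) :
    (fun x => ‖E.indicator (fun x => (v x : 𝕜)) x‖ₑ) =ᵐ[volume]
      E.indicator fun x => ENNReal.ofReal (v x) := by
  filter_upwards [hv.enorm_ae_eq] with x hx
  by_cases hE : x ∈ E
  · simp only [Set.indicator_of_mem hE, ← hx]
    rw [← ofReal_norm, RCLike.norm_ofReal, ← Real.norm_eq_abs, ofReal_norm]
  · simp [Set.indicator_of_notMem hE]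

/-- The sparse domination tested against `g = v 1_E`. -/
lemma SparseDominated.exists_indicator {r q : ℝ} (hr : 0 < r) (hq : 0 < q)
    {T : ((Fin d → ℝ) → 𝕜) → ((Fin d → ℝ) → 𝕜)} (hT : SparseDominated r ∞ q T) :
    ∃ C : ℝ≥0, ∀ v : (Fin d → ℝ) → ℝ, IsWeight v → ∀ f, MemL0 f →
      ∀ E : Set (Fin d → ℝ), MeasurableSet E → weightMeasure v E ≠ ∞ → ∀ B : ℝ≥0∞,
      (∀ α : Fin d → Fin 3, ∀ P : Finset (Set (Fin d → ℝ)), IsFinSparse volume P →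
        (∀ Q ∈ P, Q ∈ dyadicGrid α) →
        ∑ Q ∈ P, ((∫⁻ x in Q, ‖f x‖ₑ ^ r) / volume Q) ^ (q / r) *
          weightMeasure v (Q ∩ E) ≤ B) →
      ∫⁻ x in E, ‖T f x‖ₑ ^ q * ENNReal.ofReal (v x) ≤ C * B := by
  obtain ⟨C, hC⟩ := hT
  refine ⟨C ^ q * 3 ^ d, fun v hv f hf E hE hEt B hB => ?_⟩
  set g : (Fin d → ℝ) → 𝕜 := E.indicator fun x => (v x : 𝕜)
  have hgE := hv.enorm_indicator_ae_eq (𝕜 := 𝕜) E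
  have hgm : AEStronglyMeasurable g volume :=
    ((RCLike.continuous_ofReal.measurable.comp_aemeasurable hv.1).aestronglyMeasurable).indicator hE
  have hg1 : MemLp g 1 volume := by
    refine ⟨hgm, ?_⟩
    rw [eLpNorm_one_eq_lintegral_enorm, lintegral_congr_ae hgE, lintegral_indicator hE,
      ← weightMeasure_apply v hE]
    exact hEt.lt_top
  obtain ⟨S, hS, hle⟩ := hC f hf g hg1
  have hLHS : ∫⁻ x, ‖T f x‖ₑ ^ q * ‖g x‖ₑ =
      ∫⁻ x in E, ‖T f x‖ₑ ^ q * ENNReal.ofReal (v x) := by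
    rw [← lintegral_indicator hE]
    refine lintegral_congr_ae ?_
    filter_upwards [hgE] with x hx
    rw [hx]
    by_cases hxE : x ∈ E <;> simp [hxE]
  have hsum : ∑' Q : S, avg (ENNReal.ofReal r) Q f ^ q *
      avg (ENNReal.conjExponent (∞ / ENNReal.ofReal q)) Q g *
        volume (Q : Set (Fin d → ℝ)) ≤ 3 ^ d * B := by
    refine hS.tsum_le (fun Q => avg (ENNReal.ofReal r) Q f ^ q *
      avg (ENNReal.conjExponent (∞ / ENNReal.ofReal q)) Q g * volume Q) fun α P hP hPα => ?_
    refine le_trans (Finset.sum_le_sum fun Q hQ => le_of_eq ?_) (hB α P hP hPα)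
    have hc := isCube_of_mem_dyadicGrid (hPα Q hQ)
    have h1 : avg (ENNReal.conjExponent (∞ / ENNReal.ofReal q)) Q g * volume Q =
        weightMeasure v (Q ∩ E) := by
      rw [conjExponent_top_div, avg_one_eq, mul_right_comm,
        ENNReal.inv_mul_cancel hc.volume_ne_zero hc.volume_ne_top, one_mul,
        lintegral_congr_ae (ae_restrict_of_ae hgE), lintegral_indicator hE,
        Measure.restrict_restrict hE, weightMeasure_apply v (hc.measurableSet.inter hE),
        Set.inter_comm]
    rw [mul_assoc, h1, avg_rpow_eq hr]
  rw [hLHS, one_div] at hle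
  have h2 := ENNReal.rpow_le_rpow hle hq.le
  rw [ENNReal.rpow_inv_rpow hq.ne', ENNReal.mul_rpow_of_nonneg _ _ hq.le,
    ENNReal.rpow_inv_rpow hq.ne'] at h2
  refine h2.trans ?_
  rw [ENNReal.coe_mul, ENNReal.coe_rpow_of_nonneg _ hq.le, mul_assoc]
  push_cast
  gcongr

end

/-! ### The weak type bound -/

section

variable {d : ℕ} {𝕜 : Type*} [RCLike 𝕜]

/-- The estimate off the exceptional set: where the dyadic maximal function of `‖f‖ ^ r` is at
most `(δ t) ^ r`, the sparse form is small enough for the mass of `E` to be absorbed. -/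
lemma SparseDominated.exists_good_bound {r q : ℝ} (hr : 0 < r) (hq : 0 < q)
    {T : ((Fin d → ℝ) → 𝕜) → ((Fin d → ℝ) → 𝕜)} (hT : SparseDominated r ∞ q T) :
    ∃ δ C : ℝ, 0 < δ ∧ 0 < C ∧ ∀ v : (Fin d → ℝ) → ℝ, IsWeight v → ∀ Λ : ℝ, 1 ≤ Λ →
      (∀ P : Finset (Set (Fin d → ℝ)), IsFinSparse volume P → (∀ Q ∈ P, IsCube Q) →
        IsCarleson (weightMeasure v) (ENNReal.ofReal Λ) P) →
      ∀ f, MemL0 f → ∀ t : ℝ, 0 < t → ∀ E : Set (Fin d → ℝ), MeasurableSet E →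
        weightMeasure v E ≠ ∞ →
        (∀ α, Disjoint E
          (dyadicSuperlevel α (fun x => ‖f x‖ₑ ^ r) (ENNReal.ofReal ((δ * t) ^ r)))) →
        (∀ᵐ x, x ∈ E → t < ‖T f x‖) →
        ENNReal.ofReal (t ^ r) * weightMeasure v E ≤
          ENNReal.ofReal (C * levelFactor (q / r) Λ) *
            (A1const v * ∫⁻ x, ENNReal.ofReal (v x) * ‖f x‖ₑ ^ r) := by
  obtain ⟨K, hK⟩ := hT.exists_indicator hr hq
  have hp : 0 < q / r := by positivity
  obtain ⟨C₁, C₂, hC₁, hC₂, hsum⟩ :=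
    exists_sparse_sum_bound (X := Fin d → ℝ) hp
  -- `δ ^ q = 1 / M` makes the coefficient of `v(E)` at most `t ^ q / 2`.
  set M : ℝ := 2 * (K * C₁ + 1) with hM
  have hM0 : 0 < M := by positivity
  set δ : ℝ := (M⁻¹) ^ q⁻¹ with hδ
  have hδ0 : 0 < δ := by positivity
  have hδq : δ ^ q = M⁻¹ := by
    rw [hδ, ← Real.rpow_mul (by positivity), inv_mul_cancel₀ hq.ne', Real.rpow_one]
  refine ⟨δ, 2 * (K + 1) * δ ^ (q - r) * C₂, hδ0, by positivity, ?_⟩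
  intro v hv Λ hΛ hCar f hf t ht E hE hEt hdisj hET
  set τ : ℝ := (δ * t) ^ r with hτ
  have hτ0 : 0 < τ := by positivity
  set h : (Fin d → ℝ) → ℝ≥0∞ := fun x => ‖f x‖ₑ ^ r
  have hhm : AEMeasurable h := hf.1.1.enorm.pow_const r
  set σ : Measure (Fin d → ℝ) :=
    volume.withDensity fun x => ENNReal.ofReal (v x) * h x with hσ
  set Y := A1const v * ∫⁻ x, ENNReal.ofReal (v x) * h x
  have hσu : A1const v * σ Set.univ = Y := by
    rw [hσ, withDensity_apply _ MeasurableSet.univ, Measure.restrict_univ]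
  have hl : 0 < levelFactor (q / r) Λ := by linarith [one_le_levelFactor hp hΛ]
  set l := levelFactor (q / r) Λ
  have hform := hK v hv f hf E hE hEt
    (ENNReal.ofReal (C₁ * τ ^ (q / r)) * weightMeasure v E +
      ENNReal.ofReal (C₂ * l * τ ^ (q / r - 1)) * Y) (by
    intro α P hP hPα
    have hc : ∀ Q ∈ P, IsCube Q := fun Q hQ => isCube_of_mem_dyadicGrid (hPα Q hQ)
    have h1 := hsum volume (volume.withDensity h) (weightMeasure v) σ P (A1const v) Λ τ E hP hΛ
      hτ0 (hCar P hP hc) (fun Q hQ E' hE' hE'm => by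
        rw [withDensity_apply _ hE'm, hσ, withDensity_apply _ hE'm]
        exact hv.lintegral_mul_weightMeasure_le (hc Q hQ) hE' h hhm)
      (fun Q hQ hne => by
        rw [withDensity_apply _ (hc Q hQ).measurableSet]
        by_contra! hlt
        have hsub : Q ⊆ dyadicSuperlevel α h (ENNReal.ofReal τ) :=
          Set.subset_biUnion_of_mem (u := id)
            (show Q ∈ {Q | Q ∈ dyadicGrid α ∧ _ < ∫⁻ x in Q, h x} from ⟨hPα Q hQ, hlt⟩)
        refine hne ?_
        rw [((hdisj α).mono_right hsub).symm.inter_eq, measure_empty])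
    rw [hσu] at h1
    refine le_trans (Finset.sum_le_sum fun Q hQ => le_of_eq ?_) h1
    rw [withDensity_apply _ (hc Q hQ).measurableSet])
  have hlow : ENNReal.ofReal (t ^ q) * weightMeasure v E ≤
      ∫⁻ x in E, ‖T f x‖ₑ ^ q * ENNReal.ofReal (v x) := by
    rw [weightMeasure_apply v hE, ← lintegral_const_mul'' _ hv.1.ennreal_ofReal.restrict]
    refine lintegral_mono_ae ((ae_restrict_iff' hE).2 ?_)
    filter_upwards [hET] with x hx hxE
    gcongr
    rw [← ENNReal.ofReal_rpow_of_pos ht, ← ofReal_norm]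
    gcongr
    exact (hx hxE).le
  have hτp : τ ^ (q / r) = M⁻¹ * t ^ q := by
    rw [hτ, ← Real.rpow_mul (by positivity), mul_div_cancel₀ _ hr.ne',
      Real.mul_rpow hδ0.le ht.le, hδq]
  have hτp1 : τ ^ (q / r - 1) = δ ^ (q - r) * t ^ (q - r) := by
    rw [hτ, ← Real.rpow_mul (by positivity), ← Real.mul_rpow hδ0.le ht.le]
    congr 1
    field_simp
  have hhalf : K * (C₁ * τ ^ (q / r)) ≤ t ^ q / 2 := by
    have h1 : K * C₁ * M⁻¹ ≤ 1 / 2 := by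
      rw [← div_eq_mul_inv, div_le_iff₀ hM0, hM]
      linarith
    rw [hτp]
    have := mul_le_mul_of_nonneg_right h1 (Real.rpow_nonneg ht.le q)
    linarith
  set m := weightMeasure v E
  have habs : ENNReal.ofReal (t ^ q / 2) * m + ENNReal.ofReal (t ^ q / 2) * m ≤
      ENNReal.ofReal (t ^ q / 2) * m +
        ENNReal.ofReal (K * (C₂ * l * τ ^ (q / r - 1))) * Y := by
    calc _ = ENNReal.ofReal (t ^ q) * m := by
          rw [← add_mul, ← ENNReal.ofReal_add (by positivity) (by positivity), add_halves]
      _ ≤ K * (ENNReal.ofReal (C₁ * τ ^ (q / r)) * m +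
            ENNReal.ofReal (C₂ * l * τ ^ (q / r - 1)) * Y) := hlow.trans hform
      _ = ENNReal.ofReal (K * (C₁ * τ ^ (q / r))) * m +
            ENNReal.ofReal (K * (C₂ * l * τ ^ (q / r - 1))) * Y := by
          rw [ENNReal.ofReal_mul K.coe_nonneg, ENNReal.ofReal_mul K.coe_nonneg,
            ENNReal.ofReal_coe_nnreal]
          ring
      _ ≤ _ := by gcongr
  have h3 := (ENNReal.add_le_add_iff_left (ENNReal.mul_ne_top ENNReal.ofReal_ne_top hEt)).1 habs
  calc ENNReal.ofReal (t ^ r) * m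
      = ENNReal.ofReal (2 * t ^ (r - q)) * (ENNReal.ofReal (t ^ q / 2) * m) := by
        rw [← mul_assoc, ← ENNReal.ofReal_mul (by positivity)]
        congr 2
        rw [Real.rpow_sub ht]
        field_simp
    _ ≤ ENNReal.ofReal (2 * t ^ (r - q)) *
          (ENNReal.ofReal (K * (C₂ * l * τ ^ (q / r - 1))) * Y) := by gcongr
    _ = ENNReal.ofReal (2 * K * δ ^ (q - r) * C₂ * l) * Y := by
        rw [← mul_assoc, ← ENNReal.ofReal_mul (by positivity)]
        congr 2
        rw [hτp1, Real.rpow_sub ht, Real.rpow_sub ht]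
        field_simp
    _ ≤ _ := by
        gcongr
        linarith

/-- The weak type bound, with the Fujii-Wilson constant replaced by a packing constant of the
weight. -/
theorem SparseDominated.exists_weak_bound {r q : ℝ} (hr : 0 < r) (hq : 0 < q)
    {T : ((Fin d → ℝ) → 𝕜) → ((Fin d → ℝ) → 𝕜)} (hT : SparseDominated r ∞ q T)
    (hTm : ∀ f, MemL0 f → AEStronglyMeasurable (T f) volume) :
    ∃ C : ℝ, 0 < C ∧ ∀ v : (Fin d → ℝ) → ℝ, IsA1 v → ∀ Λ : ℝ, 1 ≤ Λ →
      (∀ P : Finset (Set (Fin d → ℝ)), IsFinSparse volume P → (∀ Q ∈ P, IsCube Q) →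
        IsCarleson (weightMeasure v) (ENNReal.ofReal Λ) P) →
      ∀ f, MemL0 f → ∀ t : ℝ, 0 < t →
        ENNReal.ofReal (t ^ r) * weightMeasure v {x | t < ‖T f x‖} ≤
          ENNReal.ofReal (C * levelFactor (q / r) Λ) *
            (A1const v * ∫⁻ x, ENNReal.ofReal (v x) * ‖f x‖ₑ ^ r) := by
  obtain ⟨δ, C, hδ, hC, hgood⟩ := hT.exists_good_bound hr hq
  refine ⟨C + 3 ^ d * (δ ^ r)⁻¹, by positivity, ?_⟩
  intro v hv Λ hΛ hCar f hf t ht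
  set G := (hTm f hf).mk
  have hGm : StronglyMeasurable G := (hTm f hf).stronglyMeasurable_mk
  have hGT : T f =ᵐ[volume] G := (hTm f hf).ae_eq_mk
  set h : (Fin d → ℝ) → ℝ≥0∞ := fun x => ‖f x‖ₑ ^ r
  set τ : ℝ≥0∞ := ENNReal.ofReal ((δ * t) ^ r) with hτ
  have hδt : 0 < (δ * t) ^ r := by positivity
  set Y := A1const v * ∫⁻ x, ENNReal.ofReal (v x) * h x
  set l := levelFactor (q / r) Λ
  have hl : 1 ≤ l := one_le_levelFactor (by positivity) hΛ
  have hac : weightMeasure v ≪ volume := withDensity_absolutelyContinuous _ _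
  set Ω : Set (Fin d → ℝ) := ⋃ α, dyadicSuperlevel α h τ
  have hΩm : MeasurableSet Ω := MeasurableSet.iUnion fun α => measurableSet_dyadicSuperlevel α h τ
  have hbad : ENNReal.ofReal (t ^ r) * weightMeasure v Ω ≤
      ENNReal.ofReal (3 ^ d * (δ ^ r)⁻¹) * Y := by
    have h1 : weightMeasure v Ω ≤ 3 ^ d * (τ⁻¹ * Y) := by
      calc weightMeasure v Ω ≤ ∑ α, weightMeasure v (dyadicSuperlevel α h τ) :=
            measure_iUnion_fintype_le _ _
        _ ≤ ∑ _α : Fin d → Fin 3, τ⁻¹ * Y := Finset.sum_le_sum fun α _ =>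
            hv.1.weightMeasure_dyadicSuperlevel_le (hf.1.1.enorm.pow_const r) α
              (by simpa [hτ] using hδt) ENNReal.ofReal_ne_top
        _ = _ := by simp
    calc _ ≤ ENNReal.ofReal (t ^ r) * (3 ^ d * (τ⁻¹ * Y)) := by gcongr
      _ = (ENNReal.ofReal (t ^ r) * (ENNReal.ofReal (3 ^ d) * τ⁻¹)) * Y := by
          rw [ENNReal.ofReal_pow (by norm_num)]
          norm_num
          ring
      _ = _ := by
          rw [hτ, ← ENNReal.ofReal_inv_of_pos hδt, ← ENNReal.ofReal_mul (by positivity),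
            ← ENNReal.ofReal_mul (by positivity), Real.mul_rpow hδ.le ht.le]
          congr 2
          field_simp
  -- Intersecting with cubes makes the mass finite, as the absorption requires.
  set D : ℕ → Set (Fin d → ℝ) :=
    fun n => Set.univ.pi fun _ => Set.Ico (-((n : ℝ) + 1)) (n + 1)
  set E : ℕ → Set (Fin d → ℝ) := fun n => ({x | t < ‖G x‖} \ Ω) ∩ D n
  have hDmono : Monotone D := fun n m hnm => Set.pi_mono fun i _ => by
    have : (n : ℝ) ≤ m := by exact_mod_cast hnm
    exact Set.Ico_subset_Ico (by linarith) (by linarith)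
  have hDuniv : ⋃ n, D n = Set.univ := by
    refine Set.eq_univ_of_forall fun x => Set.mem_iUnion.2 ?_
    obtain ⟨n, hn⟩ := exists_nat_ge ‖x‖
    refine ⟨n, fun i _ => ?_⟩
    have := abs_le.1 ((norm_le_pi_norm x i).trans hn)
    exact ⟨by linarith [this.1], by linarith [this.2]⟩
  have hset : MeasurableSet {x | t < ‖G x‖} :=
    measurableSet_lt measurable_const hGm.norm.measurable
  have hEn : ∀ n, ENNReal.ofReal (t ^ r) * weightMeasure v (E n) ≤
      ENNReal.ofReal (C * l) * Y := fun n => by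
    refine hgood v hv.1 Λ hΛ hCar f hf t ht (E n)
      ((hset.diff hΩm).inter (isCube_Ico n).measurableSet)
      (ne_top_of_le_ne_top (hv.weightMeasure_ne_top (isCube_Ico n))
        (measure_mono Set.inter_subset_right)) (fun α => ?_) ?_
    · exact Set.disjoint_left.2 fun x hx hx' => hx.1.2 (Set.mem_iUnion.2 ⟨α, hx'⟩)
    · filter_upwards [hGT] with x hx hxE
      rw [hx]
      exact hxE.1.1
  have hE' : ENNReal.ofReal (t ^ r) * weightMeasure v ({x | t < ‖G x‖} \ Ω) ≤
      ENNReal.ofReal (C * l) * Y := by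
    have h1 : {x | t < ‖G x‖} \ Ω = ⋃ n, E n := by
      rw [← Set.inter_iUnion, hDuniv, Set.inter_univ]
    rw [h1, Monotone.measure_iUnion fun n m hnm => Set.inter_subset_inter_right _ (hDmono hnm),
      ENNReal.mul_iSup]
    exact iSup_le hEn
  have hTG : weightMeasure v {x | t < ‖T f x‖} = weightMeasure v {x | t < ‖G x‖} := by
    refine measure_congr ?_
    filter_upwards [hac.ae_le hGT] with x hx
    exact congrArg (fun z : 𝕜 => t < ‖z‖) hx
  calc _ ≤ ENNReal.ofReal (t ^ r) *
        (weightMeasure v ({x | t < ‖G x‖} \ Ω) + weightMeasure v Ω) := by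
        rw [hTG]
        gcongr
        refine (measure_mono ?_).trans (measure_union_le _ _)
        rw [Set.sdiff_union_self]
        exact Set.subset_union_left
    _ ≤ ENNReal.ofReal (C * l) * Y + ENNReal.ofReal (3 ^ d * (δ ^ r)⁻¹) * Y := by
        rw [mul_add]
        gcongr
    _ = ENNReal.ofReal (C * l + 3 ^ d * (δ ^ r)⁻¹) * Y := by
        rw [← add_mul, ← ENNReal.ofReal_add (by positivity) (by positivity)]
    _ ≤ _ := by
        gcongr
        have : 0 < 3 ^ d * (δ ^ r)⁻¹ := by positivity
        nlinarith

end

/-! ### Weighted norms, truncation and lower semicontinuity -/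

section

variable {d : ℕ}

lemma IsCarleson.mono_const {X : Type*} [MeasurableSpace X] {ν : Measure X} {Λ Λ' : ℝ≥0∞}
    {P : Finset (Set X)} (h : IsCarleson ν Λ P) (hΛ : Λ ≤ Λ') : IsCarleson ν Λ' P :=
  fun Q hQ P' hP' hR => (h Q hQ P' hP' hR).trans (by gcongr)

lemma levelFactor_two_mul_le {p m : ℝ} (hp : 0 < p) (hm : 1 ≤ m) :
    levelFactor p (2 * m) ≤ 2 * 2 ^ (1 / p) * levelFactor p m := by
  have h2 : (1 : ℝ) ≤ 2 ^ (1 / p) := Real.one_le_rpow (by norm_num) (by positivity)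
  unfold levelFactor
  split_ifs with h
  · have h3 : (2 : ℝ) ^ (1 / p - 1) ≤ 2 ^ (1 / p) :=
      Real.rpow_le_rpow_of_exponent_le (by norm_num) (by linarith)
    have hlm := Real.log_nonneg hm
    have h4 : 1 + Real.log (2 * m) ≤ 2 * (1 + Real.log m) := by
      rw [Real.log_mul (by norm_num) (by linarith)]
      have := Real.log_two_lt_d9
      linarith
    have h5 : 0 ≤ Real.log (2 * m) := Real.log_nonneg (by linarith)
    rw [Real.mul_rpow (by norm_num) (by linarith)]
    calc _ ≤ (2 ^ (1 / p) * m ^ (1 / p - 1)) * (2 * (1 + Real.log m)) := by gcongr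
      _ = _ := by ring
  · linarith

lemma ofReal_levelFactor_rpow_le {r q : ℝ} (hr : 0 < r) (hq : 0 < q) {m : ℝ} (hm : 1 ≤ m)
    {L A : ℝ≥0∞} (hmL : ENNReal.ofReal m ≤ L) :
    A ^ (1 / r) * ENNReal.ofReal (levelFactor (q / r) m) ^ (1 / r) ≤
      if q ≤ r then A ^ (1 / r) * L ^ (1 / q - 1 / r) *
        (1 + (ENNReal.log L).toENNReal) ^ (1 / r)
      else A ^ (1 / r) := by
  have hm0 : 0 < m := by linarith
  have hlm := Real.log_nonneg hm
  unfold levelFactor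
  by_cases h : q ≤ r
  · have h' : q / r ≤ 1 := (div_le_one hr).2 h
    have hexp : 0 ≤ 1 / q - 1 / r := by
      have := one_div_le_one_div_of_le hq h
      linarith
    rw [if_pos h, if_pos h', mul_assoc]
    gcongr
    rw [ENNReal.ofReal_mul (by positivity), ENNReal.mul_rpow_of_nonneg _ _ (by positivity)]
    refine mul_le_mul' ?_ ?_
    · rw [← ENNReal.ofReal_rpow_of_pos hm0, ← ENNReal.rpow_mul]
      have : (1 / (q / r) - 1) * (1 / r) = 1 / q - 1 / r := by field_simp
      rw [this]
      gcongr
    · gcongr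
      rw [ENNReal.ofReal_add zero_le_one hlm, ENNReal.ofReal_one]
      gcongr
      have h1 : ENNReal.ofReal (Real.log m) = (ENNReal.log (ENNReal.ofReal m)).toENNReal := by
        rw [ENNReal.log_ofReal_of_pos hm0, EReal.toENNReal_of_ne_top (EReal.coe_ne_top _),
          EReal.toReal_coe]
      rw [h1]
      exact EReal.toENNReal_le_toENNReal (ENNReal.log_monotone hmL)
  · have h' : ¬ q / r ≤ 1 := by rwa [div_le_one hr]
    rw [if_neg h, if_neg h']
    simp

section Norms

variable {F : Type*} [NormedAddCommGroup F]

lemma wNorm_rpow [NormedSpace ℝ F] {r : ℝ} (hr : 0 < r) {w : (Fin d → ℝ) → ℝ} (hw : IsWeight w)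
    (f : (Fin d → ℝ) → F) :
    wNorm r w f ^ r = ∫⁻ x, ENNReal.ofReal (w x ^ r) * ‖f x‖ₑ ^ r := by
  rw [wNorm, eLpNorm_eq_lintegral_rpow_enorm_toReal (by simpa using hr) ENNReal.ofReal_ne_top,
    ENNReal.toReal_ofReal hr.le, one_div, ENNReal.rpow_inv_rpow hr.ne']
  refine lintegral_congr_ae ?_
  filter_upwards [hw.2] with x hx
  rw [enorm_smul, ENNReal.mul_rpow_of_nonneg _ _ hr.le, Real.enorm_of_nonneg hx.le,
    ENNReal.ofReal_rpow_of_pos hx]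

lemma wNorm_indicator_rpow {r : ℝ} (hr : 0 < r) {w : (Fin d → ℝ) → ℝ} (hw : IsWeight w)
    {f : (Fin d → ℝ) → F} (hf : AEStronglyMeasurable f volume) {t : ℝ} (ht : 0 < t) :
    wNorm r w ({x | t < ‖f x‖}.indicator fun _ => t) ^ r =
      ENNReal.ofReal (t ^ r) * weightMeasure (fun x => w x ^ r) {x | t < ‖f x‖} := by
  have hS : NullMeasurableSet {x | t < ‖f x‖} volume :=
    nullMeasurableSet_lt aemeasurable_const hf.norm.aemeasurable
  rw [wNorm_rpow hr hw, weightMeasure, withDensity_apply' ,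
    ← lintegral_const_mul' _ _ ENNReal.ofReal_ne_top, ← lintegral_indicator₀ hS]
  refine lintegral_congr fun x => ?_
  by_cases hx : t < ‖f x‖
  · rw [Set.indicator_of_mem (show x ∈ {x | t < ‖f x‖} from hx),
      Set.indicator_of_mem (show x ∈ {x | t < ‖f x‖} from hx), Real.enorm_of_nonneg ht.le,
      ENNReal.ofReal_rpow_of_pos ht, mul_comm]
  · rw [Set.indicator_of_notMem (show x ∉ {x | t < ‖f x‖} from hx),
      Set.indicator_of_notMem (show x ∉ {x | t < ‖f x‖} from hx)]
    simp [hr]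

lemma wWeakNorm_le {r : ℝ} (hr : 0 < r) {w : (Fin d → ℝ) → ℝ} (hw : IsWeight w)
    {f : (Fin d → ℝ) → F} (hf : AEStronglyMeasurable f volume) {N : ℝ≥0∞}
    (h : ∀ t : ℝ, 0 < t →
      ENNReal.ofReal (t ^ r) * weightMeasure (fun x => w x ^ r) {x | t < ‖f x‖} ≤ N ^ r) :
    wWeakNorm r w f ≤ N := by
  refine iSup₂_le fun t ht => ?_
  rw [← ENNReal.rpow_le_rpow_iff hr, wNorm_indicator_rpow hr hw hf ht]
  exact h t ht

lemma IsWeight.ae_iff {v : (Fin d → ℝ) → ℝ} (hv : IsWeight v) {p : (Fin d → ℝ) → Prop} :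
    (∀ᵐ x ∂weightMeasure v, p x) ↔ ∀ᵐ x, p x := by
  refine ⟨fun h => ?_, fun h => withDensity_absolutelyContinuous _ _ |>.ae_le h⟩
  refine (withDensity_absolutelyContinuous' hv.1.ennreal_ofReal ?_).ae_le h
  filter_upwards [hv.2] with x hx
  simpa using hx

lemma MemL0.sub {f g : (Fin d → ℝ) → F} (hf : MemL0 f) (hg : MemL0 g) : MemL0 (f - g) := by
  obtain ⟨hf1, K, hK, hfK⟩ := hf
  obtain ⟨hg1, K', hK', hgK⟩ := hg
  refine ⟨hf1.sub hg1, K ∪ K', hK.union hK', ?_⟩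
  filter_upwards [hfK, hgK] with x h1 h2 hx
  rw [Pi.sub_apply, h1 fun h => hx (Or.inl h), h2 fun h => hx (Or.inr h), sub_zero]

lemma MemL0.aestronglyMeasurable_smul [NormedSpace ℝ F] {f : (Fin d → ℝ) → F} (hf : MemL0 f)
    {w : (Fin d → ℝ) → ℝ} (hw : IsWeight w) :
    AEStronglyMeasurable (fun x => w x • f x) volume :=
  hw.1.aestronglyMeasurable.smul hf.1.1

lemma wNorm_add_le [NormedSpace ℝ F] (r : ℝ) (w : (Fin d → ℝ) → ℝ) {f g : (Fin d → ℝ) → F}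
    (hf : AEStronglyMeasurable (fun x => w x • f x) volume)
    (hg : AEStronglyMeasurable (fun x => w x • g x) volume) :
    wNorm r w (f + g) ≤ ENNReal.LpAddConst (ENNReal.ofReal r) * (wNorm r w f + wNorm r w g) := by
  have h : (fun x => w x • (f + g) x) = (fun x => w x • f x) + fun x => w x • g x := by
    ext x
    simp [smul_add]
  unfold wNorm
  rw [h]
  exact eLpNorm_add_le' hf hg (ENNReal.ofReal r)

lemma wNorm_sub_comm [NormedSpace ℝ F] (r : ℝ) (w : (Fin d → ℝ) → ℝ) (f g : (Fin d → ℝ) → F) :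
    wNorm r w (f - g) = wNorm r w (g - f) := by
  refine eLpNorm_congr_norm_ae (Eventually.of_forall fun x => ?_)
  simp only [Pi.sub_apply, norm_smul, norm_sub_rev]

lemma aestronglyMeasurable_smul_sub [NormedSpace ℝ F] {w : (Fin d → ℝ) → ℝ} {f g : (Fin d → ℝ) → F}
    (hf : AEStronglyMeasurable (fun x => w x • f x) volume)
    (hg : AEStronglyMeasurable (fun x => w x • g x) volume) :
    AEStronglyMeasurable (fun x => w x • (f - g) x) volume := by
  convert hf.sub hg using 1
  ext x
  simp [smul_sub]

lemma wNorm_sub_le [NormedSpace ℝ F] (r : ℝ) (w : (Fin d → ℝ) → ℝ) {f g h : (Fin d → ℝ) → F}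
    (hf : AEStronglyMeasurable (fun x => w x • f x) volume)
    (hg : AEStronglyMeasurable (fun x => w x • g x) volume)
    (hh : AEStronglyMeasurable (fun x => w x • h x) volume) :
    wNorm r w (f - g) ≤
      ENNReal.LpAddConst (ENNReal.ofReal r) * (wNorm r w (f - h) + wNorm r w (g - h)) := by
  have h1 := wNorm_add_le r w (aestronglyMeasurable_smul_sub hf hh)
    (aestronglyMeasurable_smul_sub hh hg)
  rwa [sub_add_sub_cancel, wNorm_sub_comm r w h g] at h1

/-- Lower semicontinuity of the distribution function under almost everywhere convergence. -/
lemma mul_measure_lt_norm_le_of_tendsto {X : Type*} [MeasurableSpace X] {μ : Measure X}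
    {u : ℕ → X → F} {g : X → F} (hu : ∀ᵐ x ∂μ, Tendsto (fun n => u n x) atTop (𝓝 (g x)))
    {t : ℝ} {c L : ℝ≥0∞} {a : ℕ → ℝ≥0∞} (ha : Tendsto a atTop (𝓝 L))
    (h : ∀ n, c * μ {x | t < ‖u n x‖} ≤ a n) : c * μ {x | t < ‖g x‖} ≤ L := by
  set S : ℕ → Set X := fun N => ⋂ n ≥ N, {x | t < ‖u n x‖}
  have hmono : Monotone S := fun N M hNM =>
    Set.biInter_subset_biInter_left fun n hn => le_trans hNM hn
  have hle : μ {x | t < ‖g x‖} ≤ μ (⋃ N, S N) := by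
    refine measure_mono_ae ?_
    filter_upwards [hu] with x hx hxt
    have h1 : ∀ᶠ n in atTop, t < ‖u n x‖ := hx.norm.eventually_const_lt hxt
    obtain ⟨N, hN⟩ := eventually_atTop.1 h1
    exact Set.mem_iUnion.2 ⟨N, Set.mem_iInter₂.2 hN⟩
  refine (mul_le_mul_right hle c).trans ?_
  rw [hmono.measure_iUnion, ENNReal.mul_iSup]
  refine iSup_le fun N => ge_of_tendsto ha ?_
  filter_upwards [eventually_ge_atTop N] with n hn
  refine le_trans ?_ (h n)
  gcongr
  exact Set.biInter_subset_of_mem hn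

lemma MemW.aestronglyMeasurable [NormedSpace ℝ F] {r : ℝ} {w : (Fin d → ℝ) → ℝ} (hw : IsWeight w)
    {f : (Fin d → ℝ) → F} (hf : MemW r w f) : AEStronglyMeasurable f volume := by
  have h1 : AEStronglyMeasurable (fun x => (w x)⁻¹ • (w x • f x)) volume :=
    hw.1.inv.aestronglyMeasurable.smul hf.1
  refine h1.congr ?_
  filter_upwards [hw.2] with x hx
  rw [inv_smul_smul₀ hx.ne']

/-- Truncating both the domain and the values shows that `L_0^∞` is dense in `L^r_w`. -/
lemma MemW.exists_memL0_wNorm_sub_lt [NormedSpace ℝ F] {r : ℝ} (hr : 0 < r) {w : (Fin d → ℝ) → ℝ}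
    (hw : IsWeight w) {f : (Fin d → ℝ) → F} (hf : MemW r w f) {ε : ℝ≥0∞} (hε : ε ≠ 0) :
    ∃ u : (Fin d → ℝ) → F, MemL0 u ∧ wNorm r w (u - f) < ε := by
  have hfm := hf.aestronglyMeasurable hw
  set g := hfm.mk
  have hgm : StronglyMeasurable g := hfm.stronglyMeasurable_mk
  have hfg : f =ᵐ[volume] g := hfm.ae_eq_mk
  set A : ℕ → Set (Fin d → ℝ) := fun n => {x | ‖g x‖ ≤ n} ∩ Metric.closedBall 0 n
  have hAm : ∀ n, MeasurableSet (A n) := fun n =>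
    (measurableSet_le hgm.norm.measurable measurable_const).inter
      Metric.isClosed_closedBall.measurableSet
  set u : ℕ → (Fin d → ℝ) → F := fun n => (A n).indicator g
  have hin : ∀ n x, x ∈ A n → u n x = g x := fun n x h => Set.indicator_of_mem h g
  have hout : ∀ n x, x ∉ A n → u n x = 0 := fun n x h => Set.indicator_of_notMem h g
  have hum : ∀ n, StronglyMeasurable (u n) := fun n => hgm.indicator (hAm n)
  have hu0 : ∀ n, MemL0 (u n) := fun n => by
    refine ⟨memLp_top_of_bound (hum n).aestronglyMeasurable n (Eventually.of_forall fun x => ?_),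
      Metric.closedBall 0 n, isCompact_closedBall 0 _, Eventually.of_forall fun x hx => ?_⟩
    · by_cases h : x ∈ A n
      · rw [hin n x h]
        exact h.1
      · simp [hout n x h]
    · exact hout n x fun h => hx h.2
  have hlim : Tendsto (fun n => ∫⁻ x, ENNReal.ofReal (w x ^ r) * ‖(u n - f) x‖ₑ ^ r) atTop
      (𝓝 (∫⁻ _ : Fin d → ℝ, 0)) := by
    refine tendsto_lintegral_of_dominated_convergence'
      (fun x => ENNReal.ofReal (w x ^ r) * ‖f x‖ₑ ^ r) (fun n => ?_) (fun n => ?_) ?_ ?_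
    · exact (hw.1.pow_const r).ennreal_ofReal.fun_mul
        (((hum n).aestronglyMeasurable.sub hfm).enorm.pow_const r)
    · filter_upwards [hfg] with x hx
      gcongr
      by_cases h : x ∈ A n
      · rw [Pi.sub_apply, hin n x h, hx]
        simp
      · rw [Pi.sub_apply, hout n x h, zero_sub, enorm_neg]
    · rw [← wNorm_rpow hr hw]
      exact ENNReal.rpow_ne_top_of_nonneg hr.le hf.2.ne
    · filter_upwards [hfg] with x hx
      refine tendsto_const_nhds.congr' ?_
      obtain ⟨n₁, hn₁⟩ := exists_nat_ge ‖g x‖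
      obtain ⟨n₂, hn₂⟩ := exists_nat_ge ‖x‖
      filter_upwards [eventually_ge_atTop n₁, eventually_ge_atTop n₂] with n h1 h2
      have h1' : (n₁ : ℝ) ≤ n := by exact_mod_cast h1
      have h2' : (n₂ : ℝ) ≤ n := by exact_mod_cast h2
      have hmem : x ∈ A n := ⟨hn₁.trans h1', by
        rw [mem_closedBall_zero_iff]
        exact hn₂.trans h2'⟩
      rw [Pi.sub_apply, hin n x hmem, hx]
      simp [hr]
  rw [lintegral_zero] at hlim
  have hεr : 0 < ε ^ r := by
    rcases eq_or_ne ε ∞ with rfl | h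
    · simp [ENNReal.top_rpow_of_pos hr]
    · exact ENNReal.rpow_pos (pos_iff_ne_zero.2 hε) h
  obtain ⟨n, hn⟩ := (hlim.eventually_lt_const hεr).exists
  refine ⟨u n, hu0 n, ?_⟩
  rw [← wNorm_rpow hr hw] at hn
  exact (ENNReal.rpow_lt_rpow_iff hr).1 hn

end Norms

end

/-! ### Extensions by density -/

section

variable {d : ℕ} {𝕜 : Type*} [RCLike 𝕜]

/-- The weak type bound on `L_0^∞`, with a finite constant `B`. The packing constant of `w ^ r` is
at most `2 [w ^ r]_FW` and at most `2 [w ^ r]₁`; the second bound makes `B` finite without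
recourse to the comparison of the two characteristics. -/
theorem SparseDominated.exists_norm_bound {r q : ℝ} (hr : 0 < r) (hq : 0 < q)
    {T : ((Fin d → ℝ) → 𝕜) → ((Fin d → ℝ) → 𝕜)} (hT : SparseDominated r ∞ q T)
    (hTm : ∀ f, MemL0 f → AEStronglyMeasurable (T f) volume) :
    ∃ C : ℝ≥0, ∀ w : (Fin d → ℝ) → ℝ, IsWeight w → IsA1 (fun x => w x ^ r) →
      ∃ B : ℝ≥0∞, B ≠ ∞ ∧ B ≤ C * weakBound r q (fun x => w x ^ r) ∧
        ∀ f, MemL0 f → ∀ t : ℝ, 0 < t →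
          ENNReal.ofReal (t ^ r) * weightMeasure (fun x => w x ^ r) {x | t < ‖T f x‖} ≤
            (B * wNorm r w f) ^ r := by
  obtain ⟨C₀, hC₀, hbound⟩ := hT.exists_weak_bound hr hq hTm
  have hp : 0 < q / r := by positivity
  have hr' : 0 < 1 / r := by positivity
  set c : ℝ := C₀ * (2 * 2 ^ (1 / (q / r))) with hc
  have hc0 : 0 < c := by positivity
  refine ⟨c.toNNReal ^ (1 / r), fun w hw hv => ?_⟩
  set v : (Fin d → ℝ) → ℝ := fun x => w x ^ r
  set M : ℝ≥0∞ := max 1 (min (FWconst v) (A1const v)) with hM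
  have hMt : M ≠ ∞ := max_ne_top ENNReal.one_ne_top ((min_le_right _ _).trans_lt hv.2).ne
  have hMFW : M ≤ FWconst v := max_le hv.one_le_FWconst (min_le_left _ _)
  set m := M.toReal with hm
  have hMm : ENNReal.ofReal m = M := ENNReal.ofReal_toReal hMt
  have hm1 : 1 ≤ m := by
    rw [hm, ← ENNReal.toReal_one]
    exact ENNReal.toReal_mono hMt (le_max_left _ _)
  have hCar : ∀ P : Finset (Set (Fin d → ℝ)), IsFinSparse volume P → (∀ Q ∈ P, IsCube Q) →
      IsCarleson (weightMeasure v) (ENNReal.ofReal (2 * m)) P := by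
    intro P hP hcube
    rw [ENNReal.ofReal_mul (by norm_num), hMm, ENNReal.ofReal_ofNat]
    rcases le_total (FWconst v) (A1const v) with h | h
    · refine (hv.isCarleson_FWconst hP hcube).mono_const ?_
      rw [hM, min_eq_left h]
      gcongr
      exact le_max_right _ _
    · refine (hv.1.isCarleson_A1const hP hcube).mono_const ?_
      rw [hM, min_eq_right h]
      gcongr
      exact le_max_right _ _
  set B : ℝ≥0∞ := (ENNReal.ofReal (c * levelFactor (q / r) m) * A1const v) ^ (1 / r) with hB
  refine ⟨B, ENNReal.rpow_ne_top_of_nonneg hr'.le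
    (ENNReal.mul_ne_top ENNReal.ofReal_ne_top hv.2.ne), ?_, fun f hf t ht => ?_⟩
  · have h1 := ofReal_levelFactor_rpow_le hr hq hm1 (A := A1const v) (hMm.le.trans hMFW)
    rw [hB, ENNReal.ofReal_mul hc0.le, mul_assoc, ENNReal.mul_rpow_of_nonneg _ _ hr'.le,
      ENNReal.coe_rpow_of_nonneg _ hr'.le, mul_comm (ENNReal.ofReal (levelFactor _ _)),
      ENNReal.mul_rpow_of_nonneg _ _ hr'.le]
    exact mul_le_mul_right h1 _
  · refine (hbound v hv (2 * m) (by linarith) hCar f hf t ht).trans ?_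
    rw [ENNReal.mul_rpow_of_nonneg _ _ hr.le, hB, one_div, ENNReal.rpow_inv_rpow hr.ne',
      wNorm_rpow hr hw, mul_assoc]
    refine mul_le_mul_left (ENNReal.ofReal_le_ofReal ?_) _
    calc C₀ * levelFactor (q / r) (2 * m)
        ≤ C₀ * (2 * 2 ^ (1 / (q / r)) * levelFactor (q / r) m) := by
          gcongr
          exact levelFactor_two_mul_le hp hm1
      _ = _ := by rw [hc]; ring

section Extension

variable {r : ℝ} {w : (Fin d → ℝ) → ℝ} {B : ℝ≥0∞} {T : ((Fin d → ℝ) → 𝕜) → ((Fin d → ℝ) → 𝕜)}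

/-- The bound on `L_0^∞` passes to every extension by density, at the cost of the constant of the
quasi-triangle inequality. -/
lemma IsExtension.wWeakNorm_le (hr : 0 < r) (hw : IsWeight w)
    (hv : IsWeight fun x => w x ^ r) (hBt : B ≠ ∞)
    (hTm : ∀ f, MemL0 f → AEStronglyMeasurable (T f) volume)
    (hB : ∀ f, MemL0 f → ∀ t : ℝ, 0 < t →
      ENNReal.ofReal (t ^ r) * weightMeasure (fun x => w x ^ r) {x | t < ‖T f x‖} ≤
        (B * wNorm r w f) ^ r)
    {T' : ((Fin d → ℝ) → 𝕜) → ((Fin d → ℝ) → 𝕜)} (hT' : IsExtension r w T T')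
    {f : (Fin d → ℝ) → 𝕜} (hf : MemW r w f) :
    wWeakNorm r w (T' f) ≤ B * ENNReal.LpAddConst (ENNReal.ofReal r) * wNorm r w f := by
  obtain ⟨u, hu, hlim, hae⟩ := hT'.2 f hf
  set κ := ENNReal.LpAddConst (ENNReal.ofReal r)
  have hκ : κ ≠ ∞ := (ENNReal.LpAddConst_lt_top _).ne
  have hm : AEStronglyMeasurable (T' f) volume :=
    aestronglyMeasurable_of_tendsto_ae atTop (fun n => hTm (u n) (hu n)) hae
  refine SparseWeak.wWeakNorm_le hr hw hm fun t ht => ?_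
  refine mul_measure_lt_norm_le_of_tendsto (hv.ae_iff.2 hae)
    (a := fun n => (B * κ * (wNorm r w (u n - f) + wNorm r w f)) ^ r) ?_ fun n => ?_
  · have h1 : Tendsto (fun n => B * κ * (wNorm r w (u n - f) + wNorm r w f)) atTop
        (𝓝 (B * κ * (0 + wNorm r w f))) :=
      ENNReal.Tendsto.const_mul (hlim.add tendsto_const_nhds)
        (Or.inr (ENNReal.mul_ne_top hBt hκ))
    rw [zero_add] at h1
    exact (ENNReal.continuous_rpow_const.tendsto _).comp h1
  · refine (hB (u n) (hu n) t ht).trans ?_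
    rw [mul_assoc]
    gcongr
    have h2 := wNorm_add_le r w
      (aestronglyMeasurable_smul_sub ((hu n).aestronglyMeasurable_smul hw) hf.1) hf.1
    rwa [sub_add_cancel] at h2

lemma IsExtension.ae_eq (hr : 0 < r) (hw : IsWeight w)
    (hv : IsWeight fun x => w x ^ r) (hBt : B ≠ ∞)
    (hB : ∀ f, MemL0 f → ∀ t : ℝ, 0 < t →
      ENNReal.ofReal (t ^ r) * weightMeasure (fun x => w x ^ r) {x | t < ‖T f x‖} ≤
        (B * wNorm r w f) ^ r)
    (hsub : IsSublinear T) {T₁ T₂ : ((Fin d → ℝ) → 𝕜) → ((Fin d → ℝ) → 𝕜)}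
    (h₁ : IsExtension r w T T₁) (h₂ : IsExtension r w T T₂)
    {f : (Fin d → ℝ) → 𝕜} (hf : MemW r w f) : T₁ f =ᵐ[volume] T₂ f := by
  obtain ⟨u, hu, hulim, huae⟩ := h₁.2 f hf
  obtain ⟨z, hz, hzlim, hzae⟩ := h₂.2 f hf
  set κ := ENNReal.LpAddConst (ENNReal.ofReal r)
  have hκ : κ ≠ ∞ := (ENNReal.LpAddConst_lt_top _).ne
  have hzero : ∀ t : ℝ, 0 < t →
      weightMeasure (fun x => w x ^ r) {x | t < ‖T₁ f x - T₂ f x‖} = 0 := by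
    intro t ht
    have hlim : ∀ᵐ x ∂weightMeasure (fun x => w x ^ r),
        Tendsto (fun n => T (u n) x - T (z n) x) atTop (𝓝 (T₁ f x - T₂ f x)) := by
      refine hv.ae_iff.2 ?_
      filter_upwards [huae, hzae] with x h1 h2
      exact h1.sub h2
    have h1 : Tendsto (fun n => (B * κ * (wNorm r w (u n - f) + wNorm r w (z n - f))) ^ r) atTop
        (𝓝 0) := by
      have h2 : Tendsto (fun n => B * κ * (wNorm r w (u n - f) + wNorm r w (z n - f))) atTop
          (𝓝 (B * κ * (0 + 0))) :=
        ENNReal.Tendsto.const_mul (hulim.add hzlim) (Or.inr (ENNReal.mul_ne_top hBt hκ))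
      have h3 := (ENNReal.continuous_rpow_const (y := r)).tendsto _ |>.comp h2
      rw [add_zero, mul_zero, ENNReal.zero_rpow_of_pos hr] at h3
      exact h3
    have h4 := mul_measure_lt_norm_le_of_tendsto hlim (t := t) (c := ENNReal.ofReal (t ^ r)) h1
      fun n => by
        calc _ ≤ ENNReal.ofReal (t ^ r) *
              weightMeasure (fun x => w x ^ r) {x | t < ‖T (u n - z n) x‖} := by
              refine mul_le_mul_right (measure_mono_ae ?_) _
              filter_upwards [hv.ae_iff.2 (hsub (u n) (z n) (hu n) (hz n))] with x hx hxt
              exact lt_of_lt_of_le hxt hx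
          _ ≤ (B * wNorm r w (u n - z n)) ^ r := hB _ ((hu n).sub (hz n)) t ht
          _ ≤ _ := by
              rw [mul_assoc]
              gcongr
              exact wNorm_sub_le r w ((hu n).aestronglyMeasurable_smul hw)
                ((hz n).aestronglyMeasurable_smul hw) hf.1
    have htr : ENNReal.ofReal (t ^ r) ≠ 0 := by
      have : 0 < t ^ r := by positivity
      simpa using this
    exact (mul_eq_zero.1 (le_zero_iff.1 h4)).resolve_left htr
  have hall : ∀ᵐ x ∂weightMeasure (fun x => w x ^ r), ∀ n : ℕ,
      ‖T₁ f x - T₂ f x‖ ≤ 1 / ((n : ℝ) + 1) := by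
    refine ae_all_iff.2 fun n => ?_
    have h5 := hzero (1 / ((n : ℝ) + 1)) (by positivity)
    rw [measure_eq_zero_iff_ae_notMem] at h5
    filter_upwards [h5] with x hx
    exact not_lt.1 hx
  filter_upwards [hv.ae_iff.1 hall] with x hx
  have h6 : ‖T₁ f x - T₂ f x‖ ≤ 0 :=
    ge_of_tendsto' tendsto_one_div_add_atTop_nhds_zero_nat hx
  exact sub_eq_zero.1 (norm_le_zero_iff.1 h6)

/-- If `u n → f` in `L^r_w` so fast that the masses of `{‖T (u (n + 1)) - T (u n)‖ > 2⁻ⁿ}` are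
summable, then `T (u n)` converges almost everywhere by the Borel-Cantelli lemma. -/
lemma exists_approximation (hr : 0 < r) (hw : IsWeight w)
    (hv : IsWeight fun x => w x ^ r) (hBt : B ≠ ∞)
    (hB : ∀ f, MemL0 f → ∀ t : ℝ, 0 < t →
      ENNReal.ofReal (t ^ r) * weightMeasure (fun x => w x ^ r) {x | t < ‖T f x‖} ≤
        (B * wNorm r w f) ^ r)
    (hsub : IsSublinear T) {f : (Fin d → ℝ) → 𝕜} (hf : MemW r w f) :
    ∃ (u : ℕ → (Fin d → ℝ) → 𝕜) (g : (Fin d → ℝ) → 𝕜), (∀ n, MemL0 (u n)) ∧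
      Tendsto (fun n => wNorm r w (u n - f)) atTop (𝓝 0) ∧
      ∀ᵐ x, Tendsto (fun n => T (u n) x) atTop (𝓝 (g x)) := by
  set κ := ENNReal.LpAddConst (ENNReal.ofReal r)
  have hκ : κ ≠ ∞ := (ENNReal.LpAddConst_lt_top _).ne
  set a : ℕ → ℝ≥0∞ := fun n => ENNReal.ofReal ((1 / 2) ^ n) with ha
  have ha0 : ∀ n, a n ≠ 0 := fun n => by
    have : (0 : ℝ) < (1 / 2) ^ n := by positivity
    simpa only [ha, ne_eq, ENNReal.ofReal_eq_zero, not_le] using this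
  have hat : ∀ n, a n ≠ ∞ := fun n => ENNReal.ofReal_ne_top
  have ha1 : ∀ n, a n ≤ 1 := fun n => by
    rw [ha, ← ENNReal.ofReal_one]
    exact ENNReal.ofReal_le_ofReal (pow_le_one₀ (by norm_num) (by norm_num))
  have hanti : ∀ n, a (n + 1) ≤ a n := fun n =>
    ENNReal.ofReal_le_ofReal (pow_le_pow_of_le_one (by norm_num) (by norm_num) n.le_succ)
  have halim : Tendsto a atTop (𝓝 0) := by
    rw [← ENNReal.ofReal_zero]
    exact (ENNReal.continuous_ofReal.tendsto 0).comp
      (tendsto_pow_atTop_nhds_zero_of_lt_one (by norm_num) (by norm_num))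
  -- `ε n ^ r = a n ^ r * a n`: the first factor pays for the threshold `a n = 2⁻ⁿ`, the second is
  -- summable.
  set ε : ℕ → ℝ≥0∞ := fun n => a n * a n ^ (1 / r) with hε
  have hε0 : ∀ n, ε n ≠ 0 := fun n =>
    mul_ne_zero (ha0 n) (by simp [ENNReal.rpow_eq_zero_iff, ha0 n, hat n])
  have hεanti : ∀ n, ε (n + 1) ≤ ε n := fun n =>
    mul_le_mul' (hanti n) (ENNReal.rpow_le_rpow (hanti n) (by positivity))
  have hεle : ∀ n, ε n ≤ a n := fun n =>
    mul_le_of_le_one_right' (ENNReal.rpow_le_one (ha1 n) (by positivity))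
  have hεr : ∀ n, ε n ^ r = a n ^ r * a n := fun n => by
    rw [hε, ENNReal.mul_rpow_of_nonneg _ _ hr.le, one_div, ENNReal.rpow_inv_rpow hr.ne']
  choose u hu hlt using fun n => hf.exists_memL0_wNorm_sub_lt hr hw (hε0 n)
  have hmass : ∀ n, weightMeasure (fun x => w x ^ r)
      {x | (1 / 2) ^ n < ‖T (u (n + 1)) x - T (u n) x‖} ≤ (B * κ * 2) ^ r * a n := by
    intro n
    have hpos : (0 : ℝ) < (1 / 2) ^ n := by positivity
    have har : ENNReal.ofReal (((1 / 2 : ℝ) ^ n) ^ r) = a n ^ r :=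
      (ENNReal.ofReal_rpow_of_pos hpos).symm
    have har0 : a n ^ r ≠ 0 := by simp [ENNReal.rpow_eq_zero_iff, ha0 n, hat n]
    have hart : a n ^ r ≠ ∞ := ENNReal.rpow_ne_top_of_nonneg hr.le (hat n)
    refine (ENNReal.mul_le_mul_iff_right har0 hart).1 ?_
    calc _ ≤ a n ^ r * weightMeasure (fun x => w x ^ r)
            {x | (1 / 2) ^ n < ‖T (u (n + 1) - u n) x‖} := by
          refine mul_le_mul_right (measure_mono_ae ?_) _
          filter_upwards [hv.ae_iff.2 (hsub (u (n + 1)) (u n) (hu _) (hu n))] with x hx hxt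
          exact lt_of_lt_of_le hxt hx
      _ ≤ (B * wNorm r w (u (n + 1) - u n)) ^ r := by
          rw [← har]
          exact hB _ ((hu _).sub (hu n)) _ hpos
      _ ≤ (B * (κ * (ε n + ε n))) ^ r := by
          gcongr
          refine (wNorm_sub_le r w ((hu _).aestronglyMeasurable_smul hw)
            ((hu n).aestronglyMeasurable_smul hw) hf.1).trans ?_
          gcongr
          · exact (hlt (n + 1)).le.trans (hεanti n)
          · exact (hlt n).le
      _ = ((B * κ * 2) * ε n) ^ r := by ring_nf
      _ = _ := by
          rw [ENNReal.mul_rpow_of_nonneg _ _ hr.le, hεr]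
          ring
  have hsum : ∑' n, weightMeasure (fun x => w x ^ r)
      {x | (1 / 2) ^ n < ‖T (u (n + 1)) x - T (u n) x‖} ≠ ∞ := by
    refine ne_top_of_le_ne_top ?_ (ENNReal.tsum_le_tsum hmass)
    rw [ENNReal.tsum_mul_left, ha, tsum_ofReal_pow_le (by norm_num) (by norm_num)]
    exact ENNReal.mul_ne_top (ENNReal.rpow_ne_top_of_nonneg hr.le
      (ENNReal.mul_ne_top (ENNReal.mul_ne_top hBt hκ) (by norm_num))) ENNReal.ofReal_ne_top
  have hconv : ∀ᵐ x, ∃ y, Tendsto (fun n => T (u n) x) atTop (𝓝 y) := by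
    filter_upwards [hv.ae_iff.1 (ae_eventually_notMem hsum)] with x hx
    refine cauchySeq_tendsto_of_complete (cauchySeq_of_summable_dist ?_)
    refine Summable.of_norm_bounded_eventually_nat (g := fun n => (1 / 2 : ℝ) ^ n)
      (summable_geometric_of_lt_one (by norm_num) (by norm_num)) ?_
    filter_upwards [hx] with n hn
    rw [Real.norm_of_nonneg dist_nonneg, dist_comm, dist_eq_norm]
    exact not_lt.1 hn
  refine ⟨u, fun x => limUnder atTop fun n => T (u n) x, hu, ?_, ?_⟩
  · exact tendsto_of_tendsto_of_tendsto_of_le_of_le tendsto_const_nhds halim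
      (fun n => zero_le) fun n => (hlt n).le.trans (hεle n)
  · filter_upwards [hconv] with x hx
    exact tendsto_nhds_limUnder hx

lemma exists_isExtension (hr : 0 < r) (hw : IsWeight w)
    (hv : IsWeight fun x => w x ^ r) (hBt : B ≠ ∞)
    (hB : ∀ f, MemL0 f → ∀ t : ℝ, 0 < t →
      ENNReal.ofReal (t ^ r) * weightMeasure (fun x => w x ^ r) {x | t < ‖T f x‖} ≤
        (B * wNorm r w f) ^ r)
    (hsub : IsSublinear T) : ∃ T', IsExtension r w T T' := by
  classical
  -- On `L_0^∞` the value has to be `T f` itself; elsewhere on `L^r_w` it is a limit.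
  choose u g hu hlim hae using fun (f : (Fin d → ℝ) → 𝕜) (hf : MemW r w f) =>
    exists_approximation hr hw hv hBt hB hsub hf
  refine ⟨fun f => if MemL0 f then T f else if h : MemW r w f then g f h else 0,
    fun f hf => ?_, fun f hf => ?_⟩
  · simp only [if_pos hf]
    exact EventuallyEq.rfl
  · by_cases h0 : MemL0 f
    · refine ⟨fun _ => f, fun _ => h0, ?_, ?_⟩
      · simp [wNorm]
      · simp only [if_pos h0]
        exact Eventually.of_forall fun x => tendsto_const_nhds
    · simp only [if_neg h0, dif_pos hf]
      exact ⟨u f hf, hu f hf, hlim f hf, hae f hf⟩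

end Extension

end

end SparseWeak

open SparseWeak in
theorem corollaryC {𝕜 : Type*} [RCLike 𝕜] (d : ℕ) (hd : 0 < d) (r q : ℝ) (hr : 0 < r) (hq : 0 < q)
    (T : ((Fin d → ℝ) → 𝕜) → ((Fin d → ℝ) → 𝕜))
    (hTm : ∀ f, MemL0 f → AEStronglyMeasurable (T f) volume)
    (hT : SparseDominated r ∞ q T) :
    ∃ C : ℝ≥0, ∀ w : (Fin d → ℝ) → ℝ, IsWeight w → IsA1 (fun x => w x ^ r) →
      (∀ f, MemL0 f →
        wWeakNorm r w (T f) ≤ C * weakBound r q (fun x => w x ^ r) * wNorm r w f) ∧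
      (∀ T', IsExtension r w T T' →
        weakOpNorm r w T' ≤ C * weakBound r q (fun x => w x ^ r)) ∧
      (IsSublinear T →
        (∃ T', IsExtension r w T T') ∧
        ∀ T₁ T₂, IsExtension r w T T₁ → IsExtension r w T T₂ →
          ∀ f, MemW r w f → T₁ f =ᵐ[volume] T₂ f) := by
  obtain ⟨C, hC⟩ := hT.exists_norm_bound hr hq hTm
  set κ := ENNReal.LpAddConst (ENNReal.ofReal r)
  have hκ : κ ≠ ∞ := (ENNReal.LpAddConst_lt_top _).ne
  -- The factor `1 + κ` serves both the bound on `L_0^∞` and the one for extensions.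
  refine ⟨C * (1 + κ.toNNReal), fun w hw hv => ?_⟩
  obtain ⟨B, hBt, hBle, hB⟩ := hC w hw hv
  have hcoe : ((C * (1 + κ.toNNReal) : ℝ≥0) : ℝ≥0∞) = C * (1 + κ) := by
    push_cast
    rw [ENNReal.coe_toNNReal hκ]
  rw [hcoe]
  have hle1 : B ≤ C * (1 + κ) * weakBound r q fun x => w x ^ r := by
    refine hBle.trans ?_
    gcongr
    exact le_mul_of_one_le_right' le_self_add
  have hle2 : B * κ ≤ C * (1 + κ) * weakBound r q fun x => w x ^ r := by
    calc B * κ ≤ (C * weakBound r q fun x => w x ^ r) * (1 + κ) := by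
          gcongr
          exact le_add_self
      _ = _ := by ring
  refine ⟨fun f hf => ?_, fun T' hT' => ?_, fun hsub => ⟨?_, fun T₁ T₂ h₁ h₂ f hf => ?_⟩⟩
  · exact (wWeakNorm_le hr hw (hTm f hf) (hB f hf)).trans (by gcongr)
  · refine (sInf_le fun f hf => ?_ : weakOpNorm r w T' ≤ B * κ).trans hle2
    exact hT'.wWeakNorm_le hr hw hv.1 hBt hTm hB hf
  · exact exists_isExtension hr hw hv.1 hBt hB hsub
  · exact h₁.ae_eq hr hw hv.1 hBt hB hsub h₂ hf
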